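/- \textbf{Theorem 3 (Searching by a Pauli searching oracle).} For $\alpha\in\{0,1\}^n$ let $Q_\alpha$ be the $n$-qubit Pauli string with $I$ on the qubits $j$ with $\alpha_j=0$ and $X$ on those with $\alpha_j=1$. Let $x\in\{0,1\}^n$ be the unique target of a search problem, and let $\mathcal C$ be a quantum channel on $1+n$ qubits that is a Pauli searching oracle with $\eta=\tfrac13$, i.e. $$\mathcal C[X\otimes Q_x]=\eta\,X\otimes Q_x,\qquad \mathcal C[X\otimes Q_\alpha]=-\eta\,X\otimes Q_\alpha\quad(\alpha\ne x).$$ Let $c\text{-}\mathcal C$ be a controlled version of $\mathcal C$: a channel with one additional (ancilla) qubit that applies $\mathcal C$ when the ancilla is $|1\rangle$ and does nothing when it is $|0\rangle$. Put $$\rho_{in}=\Big(\tfrac{\eta}{1+\eta}|0\rangle\langle0|+\tfrac1{1+\eta}|1\rangle\langle1|\Big)\otimes(|+\rangle\langle+|)^{\otimes(n+1)}$$ and suppose it is promised that $$\mathrm{Tr}_{anc}\big(c\text{-}\mathcal C[\rho_{in}]\big)=\frac12\begin{pmatrix}\frac12(|+\rangle\langle+|)^{\otimes n}+2^{-(n+1)}I_n&2^{-(n+1)}Q_x\\2^{-(n+1)}Q_x&\frac12(|+\rangle\langle+|)^{\otimes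 n}+2^{-(n+1)}I_n\end{pmatrix}.$$ Then the target can be found with $O(n)$ queries to $\mathcal C$ and in $\mathrm{poly}(n)$ time: for every $\delta>0$ there are a single program $P$ for a classically controlled quantum computer (a random access machine with addition and subtraction at unit cost, acting on $n+1$ qubits by resets, the gates $H$, $T$, CNOT, computational-basis measurements and applications of the oracle channel $\mathcal C$, each at unit cost), a constant $c$ and a polynomial $T$ such that for all $n$, $x$, $\mathcal C$ as above, $P$ on input $n$ always halts within $T(n)$ steps after at most $c\,n$ queries to $\mathcal C$, and outputs $x$ with probability at least $1-\delta$. -/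

import Mathlib

open scoped Matrix

noncomputable section

namespace PauliSearch

/-! ### Qubit registers, tensor products, channels -/

/-- Bit strings of length `m`; they label the computational basis of `m` qubits. -/
abbrev Bits (m : ℕ) : Type := Fin m → Fin 2

/-- Operators (complex matrices) on `m` qubits. -/
abbrev Op (m : ℕ) : Type := Matrix (Bits m) (Bits m) ℂ

/-- The tensor product `A 0 ⊗ A 1 ⊗ ⋯ ⊗ A (m-1)` of one-qubit operators. -/
def tensor {m : ℕ} (A : Fin m → Matrix (Fin 2) (Fin 2) ℂ) : Op m :=
  Matrix.of fun a b => ∏ j, A j (a j) (b j)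

/-- `M ⊗ A`, where `M` acts on an additional first qubit. -/
def front {m : ℕ} (M : Matrix (Fin 2) (Fin 2) ℂ) (A : Op m) : Op (m + 1) :=
  Matrix.of fun a b => M (a 0) (b 0) * A (Fin.tail a) (Fin.tail b)

/-- The operator with blocks `A B / C D` with respect to the first qubit. -/
def block {m : ℕ} (A B C D : Op m) : Op (m + 1) :=
  Matrix.of fun a b => (!![A, B; C, D] (a 0) (b 0)) (Fin.tail a) (Fin.tail b)

/-- Partial trace over the first qubit. -/
def traceFirst {m : ℕ} (ρ : Op (m + 1)) : Op m :=
  Matrix.of fun a b => ∑ s : Fin 2, ρ (Fin.cons s a) (Fin.cons s b)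

/-- `|s⟩⟨t|` on one qubit. -/
def ketbra (s t : Fin 2) : Matrix (Fin 2) (Fin 2) ℂ := Matrix.single s t 1

/-- The Pauli matrix `X`. -/
def pauliX : Matrix (Fin 2) (Fin 2) ℂ := !![0, 1; 1, 0]

/-- The Pauli string `Q_α`: on qubit `j` it is `I` if `α j = 0` and `X` if `α j = 1`. -/
def pauliQ {m : ℕ} (α : Bits m) : Op m :=
  tensor fun j => if α j = 0 then 1 else pauliX

/-- `(|+⟩⟨+|)^{⊗ m}`. -/
def plusState (m : ℕ) : Op m :=
  tensor fun _ => !![1 / 2, 1 / 2; 1 / 2, 1 / 2]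

/-- Quantum channels, i.e. completely positive trace preserving maps, in Kraus form. -/
def IsQuantumChannel {m : ℕ} (Φ : Op m →ₗ[ℂ] Op m) : Prop :=
  ∃ (r : ℕ) (K : Fin r → Op m),
    ∑ i, (K i)ᴴ * K i = 1 ∧ ∀ ρ, Φ ρ = ∑ i, K i * ρ * (K i)ᴴ

/-! ### The oracle -/

/-- `C` is a Pauli searching oracle with parameter `η` for the target `x`: a quantum channel on
`1 + n` qubits that maps `X ⊗ Q_x` to `η X ⊗ Q_x`, and `X ⊗ Q_α` to `-η X ⊗ Q_α` for `α ≠ x`. -/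
structure IsPauliSearchingOracle {n : ℕ} (η : ℝ) (x : Bits n)
    (C : Op (n + 1) →ₗ[ℂ] Op (n + 1)) : Prop where
  channel : IsQuantumChannel C
  target : C (front pauliX (pauliQ x)) = (η : ℂ) • front pauliX (pauliQ x)
  other : ∀ α, α ≠ x →
    C (front pauliX (pauliQ α)) = (-(η : ℂ)) • front pauliX (pauliQ α)

/-- `D` is a controlled version of `C`: a channel with one more qubit in front, which applies `C`
when that qubit is `|1⟩` and does nothing when it is `|0⟩`. (What `D` does to coherences of the
control qubit depends on an implementation of `C` and is left free.) -/
structure IsControlledVersion {m : ℕ} (C : Op m →ₗ[ℂ] Op m)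
    (D : Op (m + 1) →ₗ[ℂ] Op (m + 1)) : Prop where
  channel : IsQuantumChannel D
  off : ∀ σ, D (front (ketbra 0 0) σ) = front (ketbra 0 0) σ
  on : ∀ σ, D (front (ketbra 1 1) σ) = front (ketbra 1 1) (C σ)

/-- The input state
`(η/(1+η) |0⟩⟨0| + 1/(1+η) |1⟩⟨1|) ⊗ (|+⟩⟨+|)^{⊗ (n+1)}`. -/
def rhoIn (n : ℕ) (η : ℝ) : Op (n + 2) :=
  front (((η / (1 + η) : ℝ) : ℂ) • ketbra 0 0 + ((1 / (1 + η) : ℝ) : ℂ) • ketbra 1 1)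
    (plusState (n + 1))

/-- The promised form of the output state. -/
def rhoOut {n : ℕ} (x : Bits n) : Op (n + 1) :=
  (1 / 2 : ℂ) • block
    ((1 / 2 : ℂ) • plusState n + ((2 : ℂ) ^ (n + 1))⁻¹ • 1) (((2 : ℂ) ^ (n + 1))⁻¹ • pauliQ x)
    (((2 : ℂ) ^ (n + 1))⁻¹ • pauliQ x) ((1 / 2 : ℂ) • plusState n + ((2 : ℂ) ^ (n + 1))⁻¹ • 1)

/-! ### The machine model

A classical random access machine controlling a register of `m` qubits. The classical memory
consists of registers `reg i` and of a two-dimensional array `mem i j`, all holding natural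
numbers. The arithmetic at unit cost is addition and truncated subtraction only (no
multiplication), so that polynomially many steps are polynomial time on a Turing machine. -/

/-- Arithmetic expressions. -/
inductive Expr : Type where
  | const (k : ℕ)
  | reg (i : ℕ)
  | mem (e₁ e₂ : Expr)
  | add (e₁ e₂ : Expr)
  | sub (e₁ e₂ : Expr)

/-- Programs. Qubits are addressed by the value of an expression. -/
inductive Cmd : Type where
  | skip
  /-- `reg i := e` -/
  | assign (i : ℕ) (e : Expr)
  /-- `mem e₁ e₂ := e` -/
  | store (e₁ e₂ e : Expr)
  /-- reset a qubit to `|0⟩` -/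
  | reset (e : Expr)
  /-- Hadamard gate -/
  | hGate (e : Expr)
  /-- `T` gate -/
  | tGate (e : Expr)
  /-- controlled-NOT with control `e₁` and target `e₂` -/
  | cnot (e₁ e₂ : Expr)
  /-- `reg i :=` outcome of measuring a qubit in the computational basis -/
  | measure (i : ℕ) (e : Expr)
  /-- apply the oracle channel to the qubit register -/
  | query
  | seq (c₁ c₂ : Cmd)
  /-- if `e ≠ 0` then `c₁` else `c₂` -/
  | ite (e : Expr) (c₁ c₂ : Cmd)
  /-- while `e ≠ 0` do `c` -/
  | loop (e : Expr) (c : Cmd)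

/-- A configuration: the commands still to be executed, the classical memory, the state of the
`m` qubits, and the number of oracle queries made so far. The state `ρ` is not normalized: its
trace is the probability of the computation path that has led to the configuration. -/
structure Config (m : ℕ) where
  code : List Cmd
  reg : ℕ → ℕ
  mem : ℕ → ℕ → ℕ
  ρ : Op m
  queries : ℕ

/-- The value of an expression in a classical memory. -/
def Expr.eval (reg : ℕ → ℕ) (mem : ℕ → ℕ → ℕ) : Expr → ℕ
  | .const k => k
  | .reg i => reg i
  | .mem e₁ e₂ => mem (e₁.eval reg mem) (e₂.eval reg mem)
  | .add e₁ e₂ => e₁.eval reg mem + e₂.eval reg mem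
  | .sub e₁ e₂ => e₁.eval reg mem - e₂.eval reg mem

/-- The value of an expression in a configuration. -/
def Config.val {m : ℕ} (s : Config m) (e : Expr) : ℕ := e.eval s.reg s.mem

/-- The one-qubit operator `U` acting on qubit `q`. -/
def onQubit {m : ℕ} (q : Fin m) (U : Matrix (Fin 2) (Fin 2) ℂ) : Op m :=
  tensor (Function.update (fun _ => 1) q U)

/-- `A ρ A†`. -/
def conjBy {m : ℕ} (A ρ : Op m) : Op m := A * ρ * Aᴴ

/-- The Hadamard matrix. -/
def hadamard : Matrix (Fin 2) (Fin 2) ℂ := ((Real.sqrt 2 : ℝ) : ℂ)⁻¹ • !![1, 1; 1, -1]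

/-- The matrix of the `T` gate. -/
def tMatrix : Matrix (Fin 2) (Fin 2) ℂ :=
  !![1, 0; 0, Complex.exp ((Real.pi / 4 : ℝ) * Complex.I)]

/-- The controlled-NOT with control `q` and target `q'`, for `q ≠ q'`. -/
def cnotOp {m : ℕ} (q q' : Fin m) : Op m :=
  onQubit q (ketbra 0 0) + onQubit q (ketbra 1 1) * onQubit q' pauliX

/-- One step of the machine with oracle `C`, as the list of the possible next configurations
(there are two only for a measurement). Each step costs one unit of time, a query included.
Quantum instructions with an invalid qubit address do not touch the qubits. A configuration
without commands has halted and does not change any more. -/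
def step {m : ℕ} (C : Op m →ₗ[ℂ] Op m) (s : Config m) : List (Config m) :=
  match s.code with
  | [] => [s]
  | .skip :: k => [{ s with code := k }]
  | .assign i e :: k => [{ s with code := k, reg := Function.update s.reg i (s.val e) }]
  | .store e₁ e₂ e :: k =>
      [{ s with
          code := k
          mem := Function.update s.mem (s.val e₁)
            (Function.update (s.mem (s.val e₁)) (s.val e₂) (s.val e)) }]
  | .reset e :: k =>
      if h : s.val e < m then
        [{ s with
            code := k
            ρ := ∑ b : Fin 2, conjBy (onQubit ⟨s.val e, h⟩ (ketbra 0 b)) s.ρ }]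
      else [{ s with code := k }]
  | .hGate e :: k =>
      if h : s.val e < m then
        [{ s with code := k, ρ := conjBy (onQubit ⟨s.val e, h⟩ hadamard) s.ρ }]
      else [{ s with code := k }]
  | .tGate e :: k =>
      if h : s.val e < m then
        [{ s with code := k, ρ := conjBy (onQubit ⟨s.val e, h⟩ tMatrix) s.ρ }]
      else [{ s with code := k }]
  | .cnot e₁ e₂ :: k =>
      if h : s.val e₁ < m ∧ s.val e₂ < m ∧ s.val e₁ ≠ s.val e₂ then
        [{ s with
            code := k
            ρ := conjBy (cnotOp ⟨s.val e₁, h.1⟩ ⟨s.val e₂, h.2.1⟩) s.ρ }]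
      else [{ s with code := k }]
  | .measure i e :: k =>
      if h : s.val e < m then
        ([0, 1] : List (Fin 2)).map fun (b : Fin 2) =>
          { s with
            code := k
            reg := Function.update s.reg i (b : ℕ)
            ρ := conjBy (onQubit ⟨s.val e, h⟩ (ketbra b b)) s.ρ }
      else [{ s with code := k }]
  | .query :: k => [{ s with code := k, ρ := C s.ρ, queries := s.queries + 1 }]
  | .seq c₁ c₂ :: k => [{ s with code := c₁ :: c₂ :: k }]
  | .ite e c₁ c₂ :: k => [{ s with code := (if s.val e ≠ 0 then c₁ else c₂) :: k }]
  | .loop e c :: k => [{ s with code := if s.val e ≠ 0 then c :: .loop e c :: k else k }]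

/-- All computation paths of `t` steps: the configurations they end in. -/
def run {m : ℕ} (C : Op m →ₗ[ℂ] Op m) : ℕ → Config m → List (Config m)
  | 0, s => [s]
  | t + 1, s => (step C s).flatMap (run C t)

/-- The initial configuration of the program `P` for `n`-bit problems: `n` is in register `0`, the
rest of the classical memory is zero, and the `n + 1` qubits are in the state `|0⋯0⟩`. -/
def initial (P : Cmd) (n : ℕ) : Config (n + 1) where
  code := [P]
  reg := Function.update (fun _ => 0) 0 n
  mem := fun _ _ => 0
  ρ := tensor fun _ => ketbra 0 0
  queries := 0

/-- The output of a configuration, in row `0` of the array, is the bit string `x`. -/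
def Outputs {m n : ℕ} (s : Config m) (x : Bits n) : Prop :=
  ∀ j : Fin n, s.mem 0 j = (x j : ℕ)

open Classical in
/-- The probability that after `t` steps the program `P`, run with the oracle `C`, has halted with
output `x`. -/
def successProb {n : ℕ} (C : Op (n + 1) →ₗ[ℂ] Op (n + 1)) (P : Cmd) (t : ℕ) (x : Bits n) : ℝ :=
  ((run C t (initial P n)).map fun s =>
    if s.code = [] ∧ Outputs s x then s.ρ.trace.re else 0).sum

end PauliSearch

end

noncomputable section

namespace PauliSearch

/-! ### Program logic for the branching machine -/

section Machine

variable {m n : ℕ} {C : Op m →ₗ[ℂ] Op m}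

/-! ### Runs of the machine -/

/-! The control qubit of `rhoIn` is a classical mixture with weights 1/4 and 3/4, so the promise
determines `C (plusState (n + 1))` as `4/3 • rhoOut x - 1/3 • plusState (n + 1)`
(`oracle_plusState`). Measuring this state in the Hadamard basis yields bits `(b, y)` with a simple
law (`fullMeas_oracle`): with probability 2/3, `y` is uniform and `b = x·y` over the field with two
elements; with probability 1/3 the outcome is `b = 1`, `y = 0`, the absurd equation `0 = 1`, which
carries no information. A query thus gives a random linear equation for `x` or nothing, and Gaussian
elimination recovers `x`.

The program stores an affine space containing the target and cuts it by the hyperplane of each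
outcome (`reaches_eliminate`, `Config.Tracks.update`). The analysis uses no ranks, only a set `S` of
candidates containing that space. A wrong candidate survives a uniform equation with probability
1/2, so the expectation of `|S| - 1` shrinks per round by the factor `1/3 + 2/3 · 1/2 = 2/3`
(`sum_outcomeProb`). It starts at `2^n - 1`, and by Markov's inequality the failure probability
after `c n` rounds is at most `(2^n - 1)(2/3)^(c n)`, which a constant `c` makes small for all `n`
(`exists_query_factor`).

Non-branching code is described by `Reaches`. Measurements are handled backwards by `Wins`, whose
value is a lower bound for the weight of successful paths. The induction over rounds (`wins_rounds`)
takes the value `w (1 - (|S| - 1)(2/3)^i)` for a path of weight `w` with `i` rounds left. -/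

theorem run_add (C : Op m →ₗ[ℂ] Op m) (a b : ℕ) (s : Config m) :
    run C (a + b) s = (run C a s).flatMap (run C b) := by
  induction a generalizing s with
  | zero => simp [run]
  | succ a ih =>
    rw [Nat.add_right_comm]
    simp only [run, List.flatMap_assoc]
    congr 1
    funext s'
    exact ih s'

theorem run_of_halted (C : Op m →ₗ[ℂ] Op m) (t : ℕ) {s : Config m} (h : s.code = []) :
    run C t s = [s] := by
  induction t with
  | zero => rfl
  | succ t ih => simp [run, step, h, ih]

open Classical in
/-- The contribution of a configuration to the probability of the output `x`. -/
def payoff (x : Bits n) (s : Config m) : ℝ :=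
  if s.code = [] ∧ Outputs s x then s.ρ.trace.re else 0

/-- From the configuration `s` the machine halts within `T` steps on every path, after at most `B`
queries in total, and the paths with output `x` have total weight at least `v`. -/
def Wins (C : Op m →ₗ[ℂ] Op m) (x : Bits n) (B T : ℕ) (s : Config m) (v : ℝ) : Prop :=
  ∀ t, T ≤ t → (∀ s' ∈ run C t s, s'.code = [] ∧ s'.queries ≤ B) ∧
    v ≤ ((run C t s).map (payoff x)).sum

variable {x : Bits n} {B T T' : ℕ} {s s' : Config m} {v v' : ℝ}

theorem Wins.mono (h : Wins C x B T s v) (hT : T ≤ T') (hv : v' ≤ v) : Wins C x B T' s v' :=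
  fun t ht => ⟨(h t (hT.trans ht)).1, hv.trans (h t (hT.trans ht)).2⟩

theorem Wins.of_halted (hc : s.code = []) (hq : s.queries ≤ B) (hv : v ≤ payoff x s) :
    Wins C x B T s v := by
  intro t _
  rw [run_of_halted C t hc]
  simpa [hc, hq] using hv

theorem Wins.of_run {a : ℕ} (h : run C a s = [s']) (hw : Wins C x B T s' v) :
    Wins C x B (T + a) s v := by
  intro t ht
  obtain ⟨t', rfl⟩ : ∃ t', t = a + t' := ⟨t - a, by omega⟩
  rw [run_add, h]
  simpa using hw t' (by omega)

/-- States are unnormalized, so the path probabilities already sit in the traces and the values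
simply add. -/
theorem Wins.branch {s₁ s₂ : Config m} {v₁ v₂ : ℝ} (h : step C s = [s₁, s₂])
    (h₁ : Wins C x B T s₁ v₁) (h₂ : Wins C x B T s₂ v₂) :
    Wins C x B (T + 1) s (v₁ + v₂) := by
  intro t ht
  obtain ⟨t', rfl⟩ : ∃ t', t = t' + 1 := ⟨t - 1, by omega⟩
  have a₁ := h₁ t' (by omega)
  have a₂ := h₂ t' (by omega)
  simp only [run, h, List.flatMap_cons, List.flatMap_nil, List.append_nil, List.map_append,
    List.sum_append, List.mem_append]
  exact ⟨fun s' hs => hs.elim (a₁.1 s') (a₂.1 s'), add_le_add a₁.2 a₂.2⟩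

/-! ### Deterministic commands -/

/-- The configuration `s` with other code. -/
def Config.withCode (s : Config m) (k : List Cmd) : Config m := { s with code := k }

/-- The configuration `s` with `reg i` set to `a`. -/
def Config.setReg (s : Config m) (i a : ℕ) : Config m :=
  { s with reg := Function.update s.reg i a }

/-- The configuration `s` with `mem i j` set to `a`. -/
def Config.setMem (s : Config m) (i j a : ℕ) : Config m :=
  { s with mem := Function.update s.mem i (Function.update (s.mem i) j a) }

/-- The configuration `s` with quantum state `σ`. -/
def Config.setState (s : Config m) (σ : Op m) : Config m := { s with ρ := σ }

@[simp] theorem Config.setReg_reg (s : Config m) (i a : ℕ) :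
    (s.setReg i a).reg = Function.update s.reg i a := rfl
@[simp] theorem Config.setReg_mem (s : Config m) (i a : ℕ) : (s.setReg i a).mem = s.mem := rfl
@[simp] theorem Config.setReg_ρ (s : Config m) (i a : ℕ) : (s.setReg i a).ρ = s.ρ := rfl
@[simp] theorem Config.setReg_queries (s : Config m) (i a : ℕ) :
    (s.setReg i a).queries = s.queries := rfl
@[simp] theorem Config.setMem_reg (s : Config m) (i j a : ℕ) : (s.setMem i j a).reg = s.reg := rfl
@[simp] theorem Config.setMem_mem (s : Config m) (i j a : ℕ) :
    (s.setMem i j a).mem = Function.update s.mem i (Function.update (s.mem i) j a) := rfl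
@[simp] theorem Config.setMem_ρ (s : Config m) (i j a : ℕ) : (s.setMem i j a).ρ = s.ρ := rfl
@[simp] theorem Config.setState_reg (s : Config m) (σ : Op m) : (s.setState σ).reg = s.reg := rfl
@[simp] theorem Config.setState_mem (s : Config m) (σ : Op m) : (s.setState σ).mem = s.mem := rfl
@[simp] theorem Config.setState_ρ (s : Config m) (σ : Op m) : (s.setState σ).ρ = σ := rfl
@[simp] theorem Config.withCode_ρ (s : Config m) (k : List Cmd) : (s.withCode k).ρ = s.ρ := rfl
@[simp] theorem Config.withCode_code (s : Config m) (k : List Cmd) : (s.withCode k).code = k := rfl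

/-- On the classical memory and quantum state of `s` the command `c` acts without branching, and
leads to those of `s'` within `t` steps. The code of `s` and `s'` is irrelevant. -/
def Reaches (C : Op m →ₗ[ℂ] Op m) (c : Cmd) (t : ℕ) (s s' : Config m) : Prop :=
  ∀ k, ∃ a ≤ t, run C a (s.withCode (c :: k)) = [s'.withCode k]

theorem Reaches.wins {c : Cmd} {t : ℕ} {k : List Cmd} (h : Reaches C c t s s')
    (hw : Wins C x B T (s'.withCode k) v) : Wins C x B (T + t) (s.withCode (c :: k)) v := by
  obtain ⟨a, ha, hr⟩ := h k
  exact (Wins.of_run hr hw).mono (by omega) le_rfl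

theorem Reaches.of_step {c : Cmd} (h : ∀ k, step C (s.withCode (c :: k)) = [s'.withCode k]) :
    Reaches C c 1 s s' := fun k => ⟨1, le_rfl, by simp [run, h k]⟩

theorem Reaches.mono {c : Cmd} {t t' : ℕ} (h : Reaches C c t s s') (ht : t ≤ t') :
    Reaches C c t' s s' := fun k => by
  obtain ⟨a, ha, hr⟩ := h k
  exact ⟨a, ha.trans ht, hr⟩

theorem Reaches.skip (s : Config m) : Reaches C .skip 1 s s := .of_step fun _ => rfl

theorem Reaches.assign (s : Config m) (i : ℕ) (e : Expr) :
    Reaches C (.assign i e) 1 s (s.setReg i (s.val e)) := .of_step fun _ => rfl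

theorem Reaches.store (s : Config m) (e₁ e₂ e : Expr) :
    Reaches C (.store e₁ e₂ e) 1 s (s.setMem (s.val e₁) (s.val e₂) (s.val e)) :=
  .of_step fun _ => rfl

theorem Reaches.hGate {e : Expr} (q : Fin m) (h : s.val e = q) :
    Reaches C (.hGate e) 1 s (s.setState (conjBy (onQubit q hadamard) s.ρ)) :=
  .of_step fun k => by
    have h' : (s.withCode (.hGate e :: k)).val e = q := h
    have hlt : (s.withCode (.hGate e :: k)).val e < m := h' ▸ q.isLt
    have hq : (⟨_, hlt⟩ : Fin m) = q := Fin.ext h'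
    simp only [step, Config.withCode_code, hlt, dite_true, hq]
    rfl

theorem Reaches.reset {e : Expr} (q : Fin m) (h : s.val e = q) :
    Reaches C (.reset e) 1 s
      (s.setState (∑ b : Fin 2, conjBy (onQubit q (ketbra 0 b)) s.ρ)) :=
  .of_step fun k => by
    have h' : (s.withCode (.reset e :: k)).val e = q := h
    have hlt : (s.withCode (.reset e :: k)).val e < m := h' ▸ q.isLt
    have hq : (⟨_, hlt⟩ : Fin m) = q := Fin.ext h'
    simp only [step, Config.withCode_code, hlt, dite_true, hq]
    rfl

theorem Reaches.seq {c₁ c₂ : Cmd} {t₁ t₂ : ℕ} {s₁ s₂ s₃ : Config m}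
    (h₁ : Reaches C c₁ t₁ s₁ s₂) (h₂ : Reaches C c₂ t₂ s₂ s₃) :
    Reaches C (.seq c₁ c₂) (t₁ + t₂ + 1) s₁ s₃ := fun k => by
  obtain ⟨a, ha, hr⟩ := h₁ (c₂ :: k)
  obtain ⟨b, hb, hr'⟩ := h₂ k
  refine ⟨1 + (a + b), by omega, ?_⟩
  rw [run_add, run, show step C (s₁.withCode (.seq c₁ c₂ :: k))
    = [s₁.withCode (c₁ :: c₂ :: k)] from rfl]
  simp [run, run_add, hr, hr']

theorem Reaches.ite_true {e : Expr} {c₁ c₂ : Cmd} {t : ℕ} (he : s.val e ≠ 0)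
    (h : Reaches C c₁ t s s') : Reaches C (.ite e c₁ c₂) (t + 1) s s' := fun k => by
  obtain ⟨a, ha, hr⟩ := h k
  refine ⟨1 + a, by omega, ?_⟩
  have he' : (s.withCode (.ite e c₁ c₂ :: k)).val e ≠ 0 := he
  rw [run_add, run, show step C (s.withCode (.ite e c₁ c₂ :: k))
    = [s.withCode (c₁ :: k)] by simp only [step, Config.withCode_code, if_pos he']; rfl]
  simp [run, hr]

theorem Reaches.ite_false {e : Expr} {c₁ c₂ : Cmd} {t : ℕ} (he : s.val e = 0)
    (h : Reaches C c₂ t s s') : Reaches C (.ite e c₁ c₂) (t + 1) s s' := fun k => by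
  obtain ⟨a, ha, hr⟩ := h k
  refine ⟨1 + a, by omega, ?_⟩
  have he' : ¬ (s.withCode (.ite e c₁ c₂ :: k)).val e ≠ 0 := not_not.2 he
  rw [run_add, run, show step C (s.withCode (.ite e c₁ c₂ :: k))
    = [s.withCode (c₂ :: k)] by simp only [step, Config.withCode_code, if_neg he']; rfl]
  simp [run, hr]

theorem step_loop_true {e : Expr} {c : Cmd} (he : s.val e ≠ 0) (k : List Cmd) :
    step C (s.withCode (.loop e c :: k)) = [s.withCode (c :: .loop e c :: k)] := by
  have he' : (s.withCode (.loop e c :: k)).val e ≠ 0 := he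
  simp only [step, Config.withCode_code, if_pos he']
  rfl

theorem step_loop_false {e : Expr} {c : Cmd} (he : s.val e = 0) (k : List Cmd) :
    step C (s.withCode (.loop e c :: k)) = [s.withCode k] := by
  have he' : ¬ (s.withCode (.loop e c :: k)).val e ≠ 0 := not_not.2 he
  simp only [step, Config.withCode_code, if_neg he']
  rfl

/-! ### Counting loops -/

/-- Decrement `reg i`. -/
def decr (i : ℕ) : Cmd := .assign i (.sub (.reg i) (.const 1))

/-- While `reg i ≠ 0` do `c` and decrement `reg i`. -/
def countdown (i : ℕ) (c : Cmd) : Cmd := .loop (.reg i) (.seq c (decr i))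

/-- Execute `c` for the values `e, …, 2, 1` of `reg i`. -/
def forDown (i : ℕ) (e : Expr) (c : Cmd) : Cmd := .seq (.assign i e) (countdown i c)

/-- The invariant is indexed by the number of iterations left. An iteration costs `t + 3`: the body,
the loop test, the unfolding of `seq` and the decrement; the last `1` is the failing test. -/
theorem Reaches.countdown {i t : ℕ} {c : Cmd} (I : ℕ → Config m → Prop) {N : ℕ}
    (hbody : ∀ r < N, ∀ s, I (r + 1) s → s.reg i = r + 1 →
      ∃ s', Reaches C c t s s' ∧ s'.reg i = r + 1 ∧ I r (s'.setReg i r))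
    (hI : I N s) (hr : s.reg i = N) :
    ∃ s', Reaches C (countdown i c) (N * (t + 3) + 1) s s' ∧ I 0 s' ∧ s'.reg i = 0 := by
  induction N generalizing s with
  | zero =>
    exact ⟨s, .mono (.of_step fun k => step_loop_false (e := .reg i) hr k) (by omega), hI, hr⟩
  | succ N ih =>
    obtain ⟨s₁, h₁, hr₁, hI₁⟩ := hbody N (Nat.lt_succ_self _) s hI hr
    obtain ⟨s₂, h₂, hI₂, hr₂⟩ := ih (fun r hr => hbody r (by omega)) hI₁ (by simp)
    refine ⟨s₂, fun k => ?_, hI₂, hr₂⟩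
    have h₃ : Reaches C (.seq c (decr i)) (t + 1 + 1) s (s₁.setReg i N) := by
      refine h₁.seq ?_
      have := Reaches.assign (C := C) s₁ i (.sub (.reg i) (.const 1))
      simpa [decr, Config.val, Expr.eval, hr₁] using this
    obtain ⟨a, ha, hra⟩ := h₃ (.loop (.reg i) (.seq c (decr i)) :: k)
    obtain ⟨b, hb, hrb⟩ := h₂ k
    refine ⟨1 + (a + b), ?_, ?_⟩
    · rw [Nat.succ_mul]; omega
    · have he : s.val (.reg i) ≠ 0 := by simp [Config.val, Expr.eval, hr]
      rw [run_add, run, PauliSearch.countdown, step_loop_true he]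
      rw [PauliSearch.countdown] at hrb
      simp [run, run_add, hra, hrb]

theorem Reaches.forDown {i t : ℕ} {e : Expr} {c : Cmd} (I : ℕ → Config m → Prop) {N : ℕ}
    (he : s.val e = N)
    (hbody : ∀ r < N, ∀ s, I (r + 1) s → s.reg i = r + 1 →
      ∃ s', Reaches C c t s s' ∧ s'.reg i = r + 1 ∧ I r (s'.setReg i r))
    (hI : I N (s.setReg i N)) :
    ∃ s', Reaches C (forDown i e c) (N * (t + 3) + 3) s s' ∧ I 0 s' ∧ s'.reg i = 0 := by
  obtain ⟨s', h, h0, hr⟩ := Reaches.countdown I hbody hI (by simp)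
  refine ⟨s', ?_, h0, hr⟩
  have ha := Reaches.assign (C := C) s i e
  rw [he] at ha
  exact (ha.seq h).mono (by omega)

end Machine

/-! ### Product operators and the law of the measured outcome -/

section Tensor

variable {m n : ℕ}

/-! ### Tensor products -/

theorem tensor_mul (A B : Fin m → Matrix (Fin 2) (Fin 2) ℂ) :
    tensor A * tensor B = tensor fun j => A j * B j := by
  ext a b
  simp only [tensor, Matrix.mul_apply, Matrix.of_apply, ← Finset.prod_mul_distrib]
  rw [Finset.prod_univ_sum, Fintype.piFinset_univ]

theorem tensor_conjTranspose (A : Fin m → Matrix (Fin 2) (Fin 2) ℂ) :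
    (tensor A)ᴴ = tensor fun j => (A j)ᴴ := by
  ext a b
  simp [tensor, Matrix.conjTranspose_apply]

theorem tensor_smul (c : Fin m → ℂ) (A : Fin m → Matrix (Fin 2) (Fin 2) ℂ) :
    tensor (fun j => c j • A j) = (∏ j, c j) • tensor A := by
  ext a b
  simp [tensor, Finset.prod_mul_distrib]

theorem tensor_one : tensor (fun _ : Fin m => (1 : Matrix (Fin 2) (Fin 2) ℂ)) = 1 := by
  ext a b
  simp only [tensor, Matrix.of_apply, Matrix.one_apply]
  by_cases h : a = b
  · simp [h]
  · obtain ⟨j, hj⟩ := Function.ne_iff.1 h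
    rw [if_neg h]
    exact Finset.prod_eq_zero (Finset.mem_univ j) (if_neg hj)

theorem trace_tensor (A : Fin m → Matrix (Fin 2) (Fin 2) ℂ) :
    (tensor A).trace = ∏ j, (A j).trace := by
  simp only [Matrix.trace, tensor, Matrix.diag_apply, Matrix.of_apply]
  rw [Finset.prod_univ_sum, Fintype.piFinset_univ]

theorem front_tensor (M : Matrix (Fin 2) (Fin 2) ℂ) (A : Fin m → Matrix (Fin 2) (Fin 2) ℂ) :
    front M (tensor A) = tensor (Fin.cons M A : Fin (m + 1) → Matrix (Fin 2) (Fin 2) ℂ) := by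
  ext a b
  simp [front, tensor, Fin.prod_univ_succ, Fin.tail]

theorem conjBy_add (A ρ σ : Op m) : conjBy A (ρ + σ) = conjBy A ρ + conjBy A σ := by
  simp [conjBy, mul_add, add_mul]

theorem conjBy_sub (A ρ σ : Op m) : conjBy A (ρ - σ) = conjBy A ρ - conjBy A σ := by
  simp [conjBy, mul_sub, sub_mul]

theorem conjBy_smul (c : ℂ) (A ρ : Op m) : conjBy A (c • ρ) = c • conjBy A ρ := by
  simp [conjBy]

theorem conjBy_conjBy (A B ρ : Op m) : conjBy A (conjBy B ρ) = conjBy (A * B) ρ := by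
  simp [conjBy, Matrix.conjTranspose_mul, mul_assoc]

theorem conjBy_tensor (A B : Fin m → Matrix (Fin 2) (Fin 2) ℂ) :
    conjBy (tensor A) (tensor B) = tensor fun j => A j * B j * (A j)ᴴ := by
  rw [conjBy, tensor_conjTranspose, tensor_mul, tensor_mul]

theorem onQubit_mul_tensor (q : Fin m) (U : Matrix (Fin 2) (Fin 2) ℂ)
    (A : Fin m → Matrix (Fin 2) (Fin 2) ℂ) :
    onQubit q U * tensor A = tensor (Function.update A q (U * A q)) := by
  rw [onQubit, tensor_mul]
  congr 1
  funext j
  by_cases h : j = q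
  · subst h; simp
  · simp [h]

theorem conjBy_onQubit_tensor (q : Fin m) (U : Matrix (Fin 2) (Fin 2) ℂ)
    (A : Fin m → Matrix (Fin 2) (Fin 2) ℂ) :
    conjBy (onQubit q U) (tensor A) = tensor (Function.update A q (U * A q * Uᴴ)) := by
  rw [onQubit, conjBy_tensor]
  congr 1
  funext j
  by_cases h : j = q
  · subst h; simp
  · simp [h]

theorem tensor_update_zero (q : Fin m) (A : Fin m → Matrix (Fin 2) (Fin 2) ℂ) :
    tensor (Function.update A q 0) = 0 := by
  ext a b
  simp only [tensor, Matrix.of_apply, Matrix.zero_apply]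
  exact Finset.prod_eq_zero (Finset.mem_univ q) (by simp)

/-! ### Preparation of the plus state -/

/-- `|+⟩⟨+|`. -/
def plusProj : Matrix (Fin 2) (Fin 2) ℂ := !![1 / 2, 1 / 2; 1 / 2, 1 / 2]

/-- The basis state `|a⟩⟨a|`. -/
def basisState (a : Bits m) : Op m := tensor fun q => ketbra (a q) (a q)

theorem trace_basisState (a : Bits m) : (basisState a).trace = 1 := by
  rw [basisState, trace_tensor]
  exact Finset.prod_eq_one fun j _ => by simp [ketbra]

theorem sqrt_two_inv_sq : ((Real.sqrt 2 : ℝ) : ℂ)⁻¹ * ((Real.sqrt 2 : ℝ) : ℂ)⁻¹ = 1 / 2 := by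
  rw [← mul_inv, ← Complex.ofReal_mul, Real.mul_self_sqrt (by norm_num)]
  norm_num

theorem hadamard_conjTranspose : hadamardᴴ = hadamard := by
  ext i j
  fin_cases i <;> fin_cases j <;> simp [hadamard]

theorem plusState_eq (m : ℕ) : plusState m = tensor fun _ => plusProj := rfl

theorem ketbra_zero : ketbra 0 0 = !![1, 0; 0, 0] := by
  ext i j
  fin_cases i <;> fin_cases j <;> simp [ketbra]

theorem ketbra_one : ketbra 1 1 = !![0, 0; 0, 1] := by
  ext i j
  fin_cases i <;> fin_cases j <;> simp [ketbra]

theorem ketbra_conjTranspose (z : Fin 2) : (ketbra z z)ᴴ = ketbra z z := by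
  simp [ketbra]

theorem hadamard_zero : hadamard * ketbra 0 0 * hadamardᴴ = plusProj := by
  have h := sqrt_two_inv_sq
  rw [hadamard_conjTranspose, ketbra_zero]
  ext i j
  fin_cases i <;> fin_cases j <;>
    simp [hadamard, plusProj, Matrix.mul_apply, Fin.sum_univ_two] <;> simpa using h

/-- On a qubit in the basis state `z` only the Kraus term `b = z` survives, so the reset keeps a
product state a product. -/
theorem reset_basis (q : Fin m) (z : Fin 2) (A : Fin m → Matrix (Fin 2) (Fin 2) ℂ)
    (hA : A q = ketbra z z) :
    ∑ b : Fin 2, conjBy (onQubit q (ketbra 0 b)) (tensor A) =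
      tensor (Function.update A q (ketbra 0 0)) := by
  have key : ∀ b : Fin 2, (ketbra 0 b * ketbra z z * (ketbra 0 b)ᴴ : Matrix (Fin 2) (Fin 2) ℂ) =
      if b = z then ketbra 0 0 else 0 := by
    intro b
    by_cases h : b = z
    · subst h; simp [ketbra]
    · simp [ketbra, h]
  simp only [conjBy_onQubit_tensor, hA, key]
  rw [Finset.sum_eq_single z]
  · simp
  · intro b _ hb
    simp [hb, tensor_update_zero]
  · simp

/-! ### Measurement in the Hadamard basis -/

/-- `|z⟩⟨z| H`. -/
def measOp (z : Fin 2) : Matrix (Fin 2) (Fin 2) ℂ := ketbra z z * hadamard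

/-- The matrices `plusProj`, `1` and `pauliX` are all diagonal in the Hadamard basis. This lemma and
the next two record their diagonal entries, which is all that the measurement sees. -/
theorem measOp_plus (z : Fin 2) :
    measOp z * plusProj * (measOp z)ᴴ = (if z = 0 then 1 else 0 : ℂ) • ketbra z z := by
  have h := sqrt_two_inv_sq
  rw [measOp, Matrix.conjTranspose_mul, hadamard_conjTranspose, ketbra_conjTranspose]
  obtain rfl | rfl : z = 0 ∨ z = 1 := by fin_cases z <;> simp
  all_goals
    simp only [ketbra_zero, ketbra_one]
    ext i j
    fin_cases i <;> fin_cases j <;>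
      simp [hadamard, plusProj, Matrix.mul_apply, Fin.sum_univ_two]
    try linear_combination 2 * h

theorem measOp_one (z : Fin 2) :
    measOp z * 1 * (measOp z)ᴴ = (1 : ℂ) • ketbra z z := by
  have h := sqrt_two_inv_sq
  rw [measOp, Matrix.conjTranspose_mul, hadamard_conjTranspose, ketbra_conjTranspose]
  obtain rfl | rfl : z = 0 ∨ z = 1 := by fin_cases z <;> simp
  all_goals
    simp only [ketbra_zero, ketbra_one]
    ext i j
    fin_cases i <;> fin_cases j <;>
      simp [hadamard, Matrix.mul_apply, Fin.sum_univ_two]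
    try linear_combination 2 * h

theorem measOp_pauliX (z : Fin 2) :
    measOp z * pauliX * (measOp z)ᴴ = (if z = 0 then 1 else -1 : ℂ) • ketbra z z := by
  have h := sqrt_two_inv_sq
  rw [measOp, Matrix.conjTranspose_mul, hadamard_conjTranspose, ketbra_conjTranspose]
  obtain rfl | rfl : z = 0 ∨ z = 1 := by fin_cases z <;> simp
  all_goals
    simp only [ketbra_zero, ketbra_one]
    ext i j
    fin_cases i <;> fin_cases j <;>
      simp [hadamard, pauliX, Matrix.mul_apply, Fin.sum_univ_two]
    first | linear_combination 2 * h | linear_combination -2 * h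

/-- `σ ↦ |a⟩⟨a| H^{⊗m} σ H^{⊗m} |a⟩⟨a|`. -/
def fullMeas (a : Bits m) (σ : Op m) : Op m := conjBy (tensor fun q => measOp (a q)) σ

theorem fullMeas_tensor (a : Bits m) (A : Fin m → Matrix (Fin 2) (Fin 2) ℂ) (c : Fin m → ℂ)
    (h : ∀ q, measOp (a q) * A q * (measOp (a q))ᴴ = c q • ketbra (a q) (a q)) :
    fullMeas a (tensor A) = (∏ q, c q) • basisState a := by
  rw [fullMeas, conjBy_tensor, basisState, ← tensor_smul]
  congr 1
  funext q
  exact h q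

/-! ### The state after the query -/

/-- Writes `rhoOut` as a combination of tensor products, on which the measurement acts qubit by
qubit. -/
theorem block_eq_front (A B : Op m) : block A B B A = front 1 A + front pauliX B := by
  ext a b
  simp only [block, front, pauliX, Matrix.of_apply, Matrix.add_apply]
  generalize a 0 = i
  generalize b 0 = j
  fin_cases i <;> fin_cases j <;> simp

theorem front_add_right (M : Matrix (Fin 2) (Fin 2) ℂ) (A B : Op m) :
    front M (A + B) = front M A + front M B := by
  ext a b; simp [front, mul_add]

theorem front_smul_right (c : ℂ) (M : Matrix (Fin 2) (Fin 2) ℂ) (A : Op m) :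
    front M (c • A) = c • front M A := by
  ext a b; simp [front, mul_left_comm]

theorem front_add_left (M N : Matrix (Fin 2) (Fin 2) ℂ) (A : Op m) :
    front (M + N) A = front M A + front N A := by
  ext a b; simp [front, add_mul]

theorem front_smul_left (c : ℂ) (M : Matrix (Fin 2) (Fin 2) ℂ) (A : Op m) :
    front (c • M) A = c • front M A := by
  ext a b; simp [front, mul_assoc]

theorem traceFirst_front_ketbra (s : Fin 2) (σ : Op m) :
    traceFirst (front (ketbra s s) σ) = σ := by
  ext a b
  fin_cases s <;> simp [traceFirst, front, ketbra, Fin.sum_univ_two]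

theorem traceFirst_add (ρ σ : Op (m + 1)) : traceFirst (ρ + σ) = traceFirst ρ + traceFirst σ := by
  ext a b; simp [traceFirst]; ring

theorem traceFirst_smul (c : ℂ) (ρ : Op (m + 1)) : traceFirst (c • ρ) = c • traceFirst ρ := by
  ext a b; simp [traceFirst]; ring

/-- For `η = 1/3` the promise reads `1/4 • plusState + 3/4 • C plusState = rhoOut x`, since the
ancilla has no coherences; solve for the second term. -/
theorem oracle_plusState {x : Bits n} {C : Op (n + 1) →ₗ[ℂ] Op (n + 1)}
    {D : Op (n + 2) →ₗ[ℂ] Op (n + 2)} (hD : IsControlledVersion C D)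
    (h : traceFirst (D (rhoIn n (1 / 3))) = rhoOut x) :
    C (plusState (n + 1)) =
      (4 / 3 : ℂ) • rhoOut x - (1 / 3 : ℂ) • plusState (n + 1) := by
  rw [rhoIn, front_add_left, front_smul_left, front_smul_left, map_add, map_smul, map_smul,
    hD.off, hD.on, traceFirst_add, traceFirst_smul, traceFirst_smul, traceFirst_front_ketbra,
    traceFirst_front_ketbra] at h
  rw [← h, smul_add, smul_smul, smul_smul]
  norm_num

theorem ketbra_coeff_pauliQ (x y : Bits n) (j : Fin n) :
    measOp (y j) * (if x j = 0 then 1 else pauliX) * (measOp (y j))ᴴ =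
      (if x j = 0 ∨ y j = 0 then 1 else -1 : ℂ) • ketbra (y j) (y j) := by
  by_cases hx : x j = 0
  · simpa [hx] using measOp_one (y j)
  · simpa [hx] using measOp_pauliX (y j)

/-- The bits of `a` as a vector over the field with two elements. -/
def vec (a : Bits n) : Fin n → ZMod 2 := fun j => ((a j : ℕ) : ZMod 2)

/-- The sign `(-1)^a`. -/
def sgn (a : ZMod 2) : ℂ := if a = 0 then 1 else -1

theorem sgn_add : ∀ a b : ZMod 2, sgn (a + b) = sgn a * sgn b := by
  have h : ∀ a b : ZMod 2, (a + b = 0 ↔ (a = 0 ↔ b = 0)) := by decide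
  intro a b
  by_cases ha : a = 0 <;> by_cases hb : b = 0 <;> simp [sgn, h, ha, hb]

theorem sgn_sum {ι : Type*} (s : Finset ι) (f : ι → ZMod 2) :
    sgn (∑ i ∈ s, f i) = ∏ i ∈ s, sgn (f i) := by
  classical
  induction s using Finset.induction_on with
  | empty => simp [sgn]
  | insert a s ha ih => rw [Finset.sum_insert ha, Finset.prod_insert ha, sgn_add, ih]

theorem prod_sign (x y : Bits n) :
    (∏ j, (if x j = 0 ∨ y j = 0 then 1 else -1 : ℂ)) = sgn (vec x ⬝ᵥ vec y) := by
  rw [dotProduct, sgn_sum]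
  refine Finset.prod_congr rfl fun j _ => ?_
  have h : ∀ u w : Fin 2, ((u : ℕ) : ZMod 2) * ((w : ℕ) : ZMod 2) = 0 ↔ u = 0 ∨ w = 0 := by
    decide
  simp only [vec, sgn, h]

/-- The probability of the outcome `(b, y)` when `C |+⟩⟨+|` is measured in the Hadamard basis. -/
def outcomeProb (x : Bits n) (b : Fin 2) (y : Bits n) : ℝ :=
  1 / 3 * (if b = 1 ∧ vec y = 0 then 1 else 0) +
    2 / 3 * ((2 : ℝ) ^ n)⁻¹ * (if ((b : ℕ) : ZMod 2) = vec x ⬝ᵥ vec y then 1 else 0)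

theorem prod_indicator (y : Bits n) :
    (∏ j, (if y j = 0 then 1 else 0 : ℂ)) = if vec y = 0 then 1 else 0 := by
  have : vec y = 0 ↔ ∀ j, y j = 0 := by
    rw [funext_iff]
    refine forall_congr' fun j => ?_
    simp only [vec, Pi.zero_apply]
    generalize y j = u
    fin_cases u <;> simp
  by_cases h : vec y = 0
  · rw [if_pos h]
    exact Finset.prod_eq_one fun j _ => if_pos (this.1 h j)
  · rw [if_neg h]
    rw [this] at h
    push Not at h
    obtain ⟨j, hj⟩ := h
    exact Finset.prod_eq_zero (Finset.mem_univ j) (if_neg hj)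

/-- The plus-state part of `rhoOut` contributes `1/3 [y = 0]`, from which the subtracted plus state
removes `1/3 [b = 0, y = 0]`, leaving `1/3 [b = 1, y = 0]`. The identity and `X ⊗ Q_x` terms
contribute `2/3 · 2^(-n-1) (1 + (-1)^(b + x·y))`, which is `2/3 · 2^(-n) [b = x·y]`. -/
theorem fullMeas_oracle {x : Bits n} {C : Op (n + 1) →ₗ[ℂ] Op (n + 1)}
    (h : C (plusState (n + 1)) = (4 / 3 : ℂ) • rhoOut x - (1 / 3 : ℂ) • plusState (n + 1))
    (b : Fin 2) (y : Bits n) :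
    fullMeas (Fin.cons b y : Bits (n + 1)) (C (plusState (n + 1))) =
      (outcomeProb x b y : ℂ) • basisState (Fin.cons b y : Bits (n + 1)) := by
  have e₁ : fullMeas (Fin.cons b y : Bits (n + 1)) (plusState (n + 1)) =
      ((if b = 0 then 1 else 0) * (if vec y = 0 then 1 else 0) : ℂ) •
        basisState (Fin.cons b y : Bits (n + 1)) := by
    rw [← prod_indicator, plusState_eq, fullMeas_tensor _ _ _ fun q => measOp_plus _,
      Fin.prod_univ_succ]
    simp
  have e₂ : fullMeas (Fin.cons b y : Bits (n + 1)) (front 1 (plusState n)) =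
      (if vec y = 0 then 1 else 0 : ℂ) • basisState (Fin.cons b y : Bits (n + 1)) := by
    rw [← prod_indicator, plusState_eq, front_tensor, fullMeas_tensor _ _
      (Fin.cons 1 fun j => if y j = 0 then 1 else 0), Fin.prod_univ_succ]
    · simp
    · refine Fin.cases ?_ fun j => ?_
      · simpa using measOp_one b
      · simpa using measOp_plus (y j)
  have e₃ : fullMeas (Fin.cons b y : Bits (n + 1)) (front 1 1) =
      (1 : ℂ) • basisState (Fin.cons b y : Bits (n + 1)) := by
    rw [← tensor_one, front_tensor, fullMeas_tensor _ _ (Fin.cons 1 fun j => 1),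
      Fin.prod_univ_succ]
    · simp
    · refine Fin.cases ?_ fun j => ?_
      · simpa using measOp_one b
      · simpa using measOp_one (y j)
  have e₄ : fullMeas (Fin.cons b y : Bits (n + 1)) (front pauliX (pauliQ x)) =
      ((if b = 0 then 1 else -1) * sgn (vec x ⬝ᵥ vec y) : ℂ) •
        basisState (Fin.cons b y : Bits (n + 1)) := by
    rw [← prod_sign, pauliQ, front_tensor, fullMeas_tensor _ _
      (Fin.cons (if b = 0 then 1 else -1) fun j => if x j = 0 ∨ y j = 0 then 1 else -1),
      Fin.prod_univ_succ]
    · simp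
    · refine Fin.cases ?_ fun j => ?_
      · simpa using measOp_pauliX b
      · simpa using ketbra_coeff_pauliQ x y j
  unfold fullMeas at e₁ e₂ e₃ e₄ ⊢
  rw [h, rhoOut, block_eq_front]
  simp only [front_add_right, front_smul_right, conjBy_sub, conjBy_add, conjBy_smul, e₁, e₂, e₃,
    e₄, smul_smul, smul_add, ← add_smul, ← sub_smul]
  congr 1
  rw [outcomeProb, pow_succ]
  have hp : (2 : ℂ) ^ n ≠ 0 := pow_ne_zero _ two_ne_zero
  have hz : ∀ a : ZMod 2, a ≠ 0 → a = 1 := by decide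
  -- Rules out the combination `y = 0`, `x·y = 1` in the case check below.
  have hdot : vec y = 0 → vec x ⬝ᵥ vec y = 0 := fun h => by rw [h, dotProduct_zero]
  generalize vec x ⬝ᵥ vec y = d at *
  by_cases hd : d = 0
  · subst hd
    by_cases hy : vec y = 0 <;> fin_cases b <;> simp [sgn, hy] <;> (field_simp; ring)
  · have hy : vec y ≠ 0 := fun h => hd (hdot h)
    obtain rfl := hz d hd
    fin_cases b <;> simp [sgn, hy] <;> (field_simp; ring)

end Tensor

/-! ### Gaussian elimination over the field with two elements -/

section Elimination

variable {m n : ℕ} {C : Op m →ₗ[ℂ] Op m} {s s' : Config m}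

/-! ### The classical part of the program -/

/-- Row `i` of the array as a vector over the field with two elements. -/
def Config.row (s : Config m) (n i : ℕ) : Fin n → ZMod 2 := fun j => (s.mem i j : ZMod 2)

/-- All entries of the array are bits. -/
def Config.IsBinary (s : Config m) : Prop := ∀ i j, s.mem i j ≤ 1

/-- `s` and `s'` agree outside the array and the registers from `l` on. -/
structure Config.Frame (l : ℕ) (s s' : Config m) : Prop where
  ρ : s'.ρ = s.ρ
  queries : s'.queries = s.queries
  reg : ∀ i < l, s'.reg i = s.reg i

theorem Config.Frame.refl (l : ℕ) (s : Config m) : s.Frame l s := ⟨rfl, rfl, fun _ _ => rfl⟩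

theorem Config.Frame.trans {l : ℕ} {s₁ s₂ s₃ : Config m} (h : s₁.Frame l s₂) (h' : s₂.Frame l s₃) :
    s₁.Frame l s₃ :=
  ⟨h'.ρ.trans h.ρ, h'.queries.trans h.queries, fun i hi => (h'.reg i hi).trans (h.reg i hi)⟩

theorem Config.Frame.mono {l l' : ℕ} (h : s.Frame l s') (hl : l' ≤ l) : s.Frame l' s' :=
  ⟨h.ρ, h.queries, fun i hi => h.reg i (hi.trans_le hl)⟩

theorem Config.Frame.setReg {l i a : ℕ} (h : s.Frame l s') (hl : l ≤ i) :
    s.Frame l (s'.setReg i a) :=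
  ⟨h.ρ, h.queries, fun j hj => by
    rw [Config.setReg_reg, Function.update_of_ne (by omega)]; exact h.reg j hj⟩

theorem Config.Frame.setMem {l i j a : ℕ} (h : s.Frame l s') : s.Frame l (s'.setMem i j a) :=
  ⟨h.ρ, h.queries, h.reg⟩

theorem Config.row_congr {i i' : ℕ} (h : s'.mem i' = s.mem i) : s'.row n i' = s.row n i := by
  funext j; simp [Config.row, h]

/-- `reg 6 - 1`, the column treated by the inner loops. -/
def col : Expr := .sub (.reg 6) (.const 1)

/-- Add the product of row `reg 2` and row `n + 2` to the parity `reg 5`. -/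
def dotRow : Cmd :=
  forDown 6 (.reg 0)
    (.ite (.mem (.reg 2) col)
      (.ite (.mem (.add (.reg 0) (.const 2)) col)
        (.assign 5 (.sub (.const 1) (.reg 5))) .skip) .skip)

theorem zmod_two_cast_one_sub {a : ℕ} (h : a ≤ 1) : ((1 - a : ℕ) : ZMod 2) = (a : ZMod 2) + 1 := by
  interval_cases a <;> decide

theorem zmod_two_cast_xor {a b : ℕ} (ha : a ≤ 1) (hb : b ≤ 1) :
    ((a - b + (b - a) : ℕ) : ZMod 2) = (a : ZMod 2) + b := by
  interval_cases a <;> interval_cases b <;> decide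

theorem zmod_two_cast_ne_zero {a : ℕ} (ha : a ≤ 1) (h : a ≠ 0) : (a : ZMod 2) = 1 := by
  obtain rfl : a = 1 := by omega
  simp

/-- The parity is accumulated on top of the initial value of `reg 5`, so that a right-hand side can
be loaded there beforehand. -/
theorem reaches_dotRow (hn : s.reg 0 = n) (hb : s.IsBinary) (h5 : s.reg 5 ≤ 1) :
    ∃ s', Reaches C dotRow (n * 6 + 3) s s' ∧ s.Frame 5 s' ∧ s'.mem = s.mem ∧
      s'.reg 5 ≤ 1 ∧
      (s'.reg 5 : ZMod 2) = s.reg 5 + s.row n (s.reg 2) ⬝ᵥ s.row n (n + 2) := by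
  refine Exists.elim (Reaches.forDown (C := C) (i := 6) (t := 3) (s := s)
    (e := .reg 0) (N := n) (c := .ite (.mem (.reg 2) col)
      (.ite (.mem (.add (.reg 0) (.const 2)) col)
        (.assign 5 (.sub (.const 1) (.reg 5))) .skip) .skip)
    (fun r s' => s.Frame 5 s' ∧ s'.mem = s.mem ∧ s'.reg 5 ≤ 1 ∧
      (s'.reg 5 : ZMod 2) = s.reg 5 +
        ∑ j ∈ Finset.Ico r n, (s.mem (s.reg 2) j : ZMod 2) * (s.mem (n + 2) j : ZMod 2))
    hn ?_ ?_) ?_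
  rotate_left 2
  · rintro s' ⟨h, ⟨hf, hm, h1, hd⟩, -⟩
    refine ⟨s', h, hf, hm, h1, ?_⟩
    rw [hd, dotProduct, ← Finset.range_eq_Ico, Finset.sum_range]
    rfl
  · rintro r hr s₁ ⟨hf, hm, h1, hd⟩ h6
    have r0 := hf.reg 0 (by norm_num)
    have r2 := hf.reg 2 (by norm_num)
    have v1 : s₁.val (.mem (.reg 2) col) = s.mem (s.reg 2) r := by
      simp [Config.val, Expr.eval, col, h6, r2, hm]
    have v2 : s₁.val (.mem (.add (.reg 0) (.const 2)) col) = s.mem (n + 2) r := by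
      simp [Config.val, Expr.eval, col, h6, r0, hn, hm]
    rw [Finset.sum_eq_sum_Ico_succ_bot hr]
    by_cases c1 : s.mem (s.reg 2) r = 0
    · refine ⟨s₁, (Reaches.ite_false (v1.trans c1) (.skip _)).mono (by norm_num), h6,
        hf.setReg (by norm_num), hm, by simpa using h1, ?_⟩
      simp [hd, c1]
    · by_cases c2 : s.mem (n + 2) r = 0
      · refine ⟨s₁, (Reaches.ite_true (v1.trans_ne c1)
          (Reaches.ite_false (v2.trans c2) (.skip _))).mono (by norm_num), h6,
          hf.setReg (by norm_num), hm, by simpa using h1, ?_⟩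
        simp [hd, c2]
      · refine ⟨s₁.setReg 5 (1 - s₁.reg 5), (Reaches.ite_true (v1.trans_ne c1)
          (Reaches.ite_true (v2.trans_ne c2) (.assign _ _ _))), by simpa using h6,
          (hf.setReg le_rfl).setReg (by norm_num), hm, by simp, ?_⟩
        simp only [Config.setReg_reg, ne_eq, Nat.reduceEqDiff,
          not_false_eq_true, Function.update_of_ne, Function.update_self]
        rw [zmod_two_cast_one_sub h1, hd, zmod_two_cast_ne_zero (hb _ _) c1,
          zmod_two_cast_ne_zero (hb _ _) c2]
        ring
  · refine ⟨(Config.Frame.refl _ _).setReg (by norm_num), rfl, by simpa using h5, ?_⟩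
    simp

/-- Add row `reg 4` to row `reg 2`. -/
def addRow : Cmd :=
  forDown 6 (.reg 0)
    (.store (.reg 2) col
      (.add (.sub (.mem (.reg 2) col) (.mem (.reg 4) col))
        (.sub (.mem (.reg 4) col) (.mem (.reg 2) col))))

/-- With truncated subtraction `(a - b) + (b - a)` is the exclusive or of two bits. Distinct rows
are required so that the source stays intact during the loop. -/
theorem reaches_addRow (hn : s.reg 0 = n) (hb : s.IsBinary) (h24 : s.reg 2 ≠ s.reg 4) :
    ∃ s', Reaches C addRow (n * 4 + 3) s s' ∧ s.Frame 5 s' ∧ s'.IsBinary ∧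
      (∀ i, i ≠ s.reg 2 → s'.mem i = s.mem i) ∧
      s'.row n (s.reg 2) = s.row n (s.reg 2) + s.row n (s.reg 4) := by
  refine Exists.elim (Reaches.forDown (C := C) (i := 6) (t := 1) (s := s)
    (e := .reg 0) (N := n) (c := .store (.reg 2) col
      (.add (.sub (.mem (.reg 2) col) (.mem (.reg 4) col))
        (.sub (.mem (.reg 4) col) (.mem (.reg 2) col))))
    (fun r s' => s.Frame 5 s' ∧ s'.IsBinary ∧ (∀ i, i ≠ s.reg 2 → s'.mem i = s.mem i) ∧
      ∀ j, (s'.mem (s.reg 2) j : ZMod 2) = s.mem (s.reg 2) j +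
        if r ≤ j ∧ j < n then (s.mem (s.reg 4) j : ZMod 2) else 0)
    hn ?_ ?_) ?_
  rotate_left 2
  · rintro s' ⟨h, ⟨hf, hb', hm, hd⟩, -⟩
    refine ⟨s', h, hf, hb', hm, ?_⟩
    funext j
    simp [Config.row, hd]
  · rintro r hr s₁ ⟨hf, hb', hm, hd⟩ h6
    have r2 := hf.reg 2 (by norm_num)
    have r4 := hf.reg 4 (by norm_num)
    refine ⟨_, Reaches.store _ _ _ _, h6, hf.setMem.setReg (by norm_num), ?_, ?_, ?_⟩
    · intro i j
      have e1 := hb' (s.reg 2) r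
      have e2 := hb' (s.reg 4) r
      have := hb' i j
      have := hb' (s.reg 2) j
      simp only [Config.setReg_mem, Config.setMem_mem, Config.val, Expr.eval, col, h6, r2, r4,
        Function.update_apply, Nat.add_sub_cancel, ite_apply]
      split_ifs <;> omega
    · intro i hi
      simp only [Config.setReg_mem, Config.setMem_mem, Config.val, Expr.eval, r2]
      rw [Function.update_of_ne hi, hm i hi]
    · intro j
      simp only [Config.setReg_mem, Config.setMem_mem, Config.val, Expr.eval, col, h6, r2, r4,
        Nat.add_sub_cancel, Function.update_self]
      by_cases hj : j = r
      · subst hj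
        rw [Function.update_self, zmod_two_cast_xor (hb' _ _) (hb' _ _), hd, hm _ h24.symm]
        simp [hr]
      · rw [Function.update_of_ne hj, hd]
        congr 2
        simp only [eq_iff_iff]
        omega
  · refine ⟨(Config.Frame.refl _ _).setReg (by norm_num), hb, fun _ _ => rfl, fun j => ?_⟩
    rw [if_neg (by omega)]
    simp

/-- Set row `reg 4` to zero. -/
def clearRow : Cmd := forDown 6 (.reg 0) (.store (.reg 4) col (.const 0))

theorem reaches_clearRow (hn : s.reg 0 = n) (hb : s.IsBinary) :
    ∃ s', Reaches C clearRow (n * 4 + 3) s s' ∧ s.Frame 5 s' ∧ s'.IsBinary ∧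
      (∀ i, i ≠ s.reg 4 → s'.mem i = s.mem i) ∧ s'.row n (s.reg 4) = 0 := by
  refine Exists.elim (Reaches.forDown (C := C) (i := 6) (t := 1) (s := s)
    (e := .reg 0) (N := n) (c := .store (.reg 4) col (.const 0))
    (fun r s' => s.Frame 5 s' ∧ s'.IsBinary ∧ (∀ i, i ≠ s.reg 4 → s'.mem i = s.mem i) ∧
      ∀ j, r ≤ j → j < n → s'.mem (s.reg 4) j = 0)
    hn ?_ ?_) ?_
  rotate_left 2
  · rintro s' ⟨h, ⟨hf, hb', hm, hd⟩, -⟩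
    refine ⟨s', h, hf, hb', hm, ?_⟩
    funext j
    simp [Config.row, hd]
  · rintro r hr s₁ ⟨hf, hb', hm, hd⟩ h6
    have r4 := hf.reg 4 (by norm_num)
    refine ⟨_, Reaches.store _ _ _ _, h6, hf.setMem.setReg (by norm_num), ?_, ?_, ?_⟩
    · intro i j
      have := hb' i j
      have := hb' (s.reg 4) j
      simp only [Config.setReg_mem, Config.setMem_mem, Config.val, Expr.eval, col, h6, r4,
        Function.update_apply, Nat.add_sub_cancel, ite_apply]
      split_ifs <;> omega
    · intro i hi
      simp only [Config.setReg_mem, Config.setMem_mem, Config.val, Expr.eval, r4]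
      rw [Function.update_of_ne hi, hm i hi]
    · intro j hj hjn
      simp only [Config.setReg_mem, Config.setMem_mem, Config.val, Expr.eval, col, h6, r4,
        Nat.add_sub_cancel, Function.update_self]
      by_cases hj' : j = r
      · rw [hj', Function.update_self]
      · rw [Function.update_of_ne hj', hd j (by omega) hjn]
  · exact ⟨(Config.Frame.refl _ _).setReg (by norm_num), hb, fun _ _ => rfl,
      fun j hj hj' => by omega⟩

/-- If row `reg 2` has odd product with row `n + 2`, add the pivot row `reg 4` to it, or make it
the pivot row if there is none yet. -/
def pivotStep : Cmd :=
  .seq (.assign 5 (.const 0)) (.seq dotRow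
    (.ite (.reg 5)
      (.ite (.sub (.add (.reg 0) (.const 1)) (.reg 4)) addRow (.assign 4 (.reg 2))) .skip))

/-- The value `n + 1` of `reg 4` encodes that no pivot has been found. The three alternatives are:
even product, new pivot, elimination by the existing pivot. -/
theorem reaches_pivotStep (hn : s.reg 0 = n) (hb : s.IsBinary) (h24 : s.reg 2 < s.reg 4)
    (h4 : s.reg 4 ≤ n + 1) :
    ∃ s', Reaches C pivotStep (n * 10 + 13) s s' ∧ s.Frame 4 s' ∧ s'.IsBinary ∧
      (∀ i, i ≠ s.reg 2 → s'.mem i = s.mem i) ∧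
      ((s.row n (s.reg 2) ⬝ᵥ s.row n (n + 2) = 0 ∧ s'.reg 4 = s.reg 4 ∧ s'.mem = s.mem) ∨
       (s.row n (s.reg 2) ⬝ᵥ s.row n (n + 2) = 1 ∧ s.reg 4 = n + 1 ∧ s'.reg 4 = s.reg 2 ∧
          s'.mem = s.mem) ∨
       (s.row n (s.reg 2) ⬝ᵥ s.row n (n + 2) = 1 ∧ s.reg 4 ≤ n ∧ s'.reg 4 = s.reg 4 ∧
          s'.row n (s.reg 2) = s.row n (s.reg 2) + s.row n (s.reg 4))) := by
  obtain ⟨s₁, h₁, f₁, m₁, b₁, d₁⟩ := reaches_dotRow (C := C) (s := s.setReg 5 0) (n := n)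
    (by simpa using hn) hb (by simp)
  have f₁' : s.Frame 5 s₁ := ((Config.Frame.refl 5 s).setReg le_rfl).trans f₁
  have hd : (s₁.reg 5 : ZMod 2) = s.row n (s.reg 2) ⬝ᵥ s.row n (n + 2) := by
    have e : ∀ i, (s.setReg 5 0).row n i = s.row n i := fun _ => rfl
    simp [d₁, e]
  have hm : s₁.mem = s.mem := m₁
  have hb₁ : s₁.IsBinary := by rw [Config.IsBinary, hm]; exact hb
  have r0 := f₁'.reg 0 (by norm_num)
  have r2 := f₁'.reg 2 (by norm_num)
  have r4 := f₁'.reg 4 (by norm_num)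
  have ha : Reaches C (.assign 5 (.const 0)) 1 s (s.setReg 5 0) := .assign _ _ _
  rw [← hd]
  by_cases c : s₁.reg 5 = 0
  · refine ⟨s₁, (ha.seq (h₁.seq (.ite_false (e := .reg 5) c (.skip _)))).mono (by omega),
      f₁'.mono (by norm_num), hb₁, fun i _ => by rw [hm], .inl ⟨by simp [c], r4, hm⟩⟩
  · have c' : s₁.val (.reg 5) ≠ 0 := c
    have d1 := zmod_two_cast_ne_zero b₁ c
    have hv : s₁.val (.sub (.add (.reg 0) (.const 1)) (.reg 4)) = n + 1 - s.reg 4 := by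
      simp [Config.val, Expr.eval, r0, hn, r4]
    by_cases e : s.reg 4 = n + 1
    · have hs : Reaches C (.assign 4 (.reg 2)) 1 s₁ (s₁.setReg 4 (s₁.reg 2)) := .assign _ _ _
      refine ⟨_, (ha.seq (h₁.seq (.ite_true c' (.ite_false (by omega) hs)))).mono (by omega),
        (f₁'.mono (by norm_num)).setReg le_rfl, hb₁, fun i _ => by simp [hm],
        .inr (.inl ⟨d1, e, by simp [r2], hm⟩)⟩
    · obtain ⟨s₂, h₂, f₂, b₂, m₂, w₂⟩ := reaches_addRow (C := C) (s := s₁) (n := n)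
        (by rw [r0, hn]) hb₁ (by omega)
      refine ⟨s₂, (ha.seq (h₁.seq (.ite_true c' (.ite_true (by omega) h₂)))).mono (by omega),
        (f₁'.trans f₂).mono (by norm_num), b₂, fun i hi => ?_,
        .inr (.inr ⟨d1, by omega, (f₂.reg 4 (by norm_num)).trans r4, ?_⟩)⟩
      · rw [m₂ i (by rwa [r2]), hm]
      · rw [r2, r4] at w₂
        have er : ∀ i, s₁.row n i = s.row n i := fun i => Config.row_congr (by rw [hm])
        rw [w₂, er, er]

/-- Pivot search and elimination in the rows `n, …, 1`. -/
def pivotLoop : Cmd :=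
  .seq (.assign 4 (.add (.reg 0) (.const 1))) (forDown 2 (.reg 0) pivotStep)

/-- The pivot is the first row of odd product met on the way down. The rows passed before it have
even product, so the elimination formula holds for them too, with coefficient `0`. -/
theorem reaches_pivotLoop (hn : s.reg 0 = n) (hb : s.IsBinary) :
    ∃ s', Reaches C pivotLoop (n * (n * 10 + 16) + 5) s s' ∧ s.Frame 2 s' ∧
      s'.reg 3 = s.reg 3 ∧ s'.reg 2 = 0 ∧ s'.IsBinary ∧
      (∀ i, i = 0 ∨ n < i → s'.mem i = s.mem i) ∧
      ((s'.reg 4 = n + 1 ∧ s'.mem = s.mem ∧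
          ∀ i, 1 ≤ i → i ≤ n → s.row n i ⬝ᵥ s.row n (n + 2) = 0) ∨
       (1 ≤ s'.reg 4 ∧ s'.reg 4 ≤ n ∧ s'.mem (s'.reg 4) = s.mem (s'.reg 4) ∧
          s.row n (s'.reg 4) ⬝ᵥ s.row n (n + 2) = 1 ∧
          ∀ i, 1 ≤ i → i ≤ n → i ≠ s'.reg 4 → s'.row n i =
            s.row n i + (s.row n i ⬝ᵥ s.row n (n + 2)) • s.row n (s'.reg 4))) := by
  have ha : Reaches C (.assign 4 (.add (.reg 0) (.const 1))) 1 s (s.setReg 4 (n + 1)) := by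
    simpa [Config.val, Expr.eval, hn] using
      Reaches.assign (C := C) s 4 (.add (.reg 0) (.const 1))
  refine Exists.elim (Reaches.forDown (C := C) (i := 2)
    (t := n * 10 + 13) (s := s.setReg 4 (n + 1)) (e := .reg 0) (N := n) (c := pivotStep)
    (fun r s' => s.Frame 2 s' ∧ s'.reg 3 = s.reg 3 ∧ s'.IsBinary ∧
      (∀ i, i ≤ r ∨ n < i → s'.mem i = s.mem i) ∧
      ((s'.reg 4 = n + 1 ∧ s'.mem = s.mem ∧
          ∀ i, r < i → i ≤ n → s.row n i ⬝ᵥ s.row n (n + 2) = 0) ∨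
       (r < s'.reg 4 ∧ s'.reg 4 ≤ n ∧ s'.mem (s'.reg 4) = s.mem (s'.reg 4) ∧
          s.row n (s'.reg 4) ⬝ᵥ s.row n (n + 2) = 1 ∧
          ∀ i, r < i → i ≤ n → i ≠ s'.reg 4 → s'.row n i =
            s.row n i + (s.row n i ⬝ᵥ s.row n (n + 2)) • s.row n (s'.reg 4))))
    (by simpa [Config.val, Expr.eval] using hn) ?_ ?_) ?_
  rotate_left 2
  · rintro s' ⟨h, ⟨hf, h3, hb', hm, hd⟩, h2⟩
    refine ⟨s', (ha.seq h).mono (by ring_nf; omega), hf, h3, h2, hb', fun i hi => hm i (by omega), ?_⟩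
    simpa only [Nat.lt_iff_add_one_le, zero_add] using hd
  · rintro r hr s₁ ⟨hf, h3, hb₁, hm, hd⟩ h2
    have h4 : r + 1 < s₁.reg 4 ∧ s₁.reg 4 ≤ n + 1 := by
      rcases hd with hd | hd <;> omega
    have e₁ : s₁.row n (r + 1) = s.row n (r + 1) := Config.row_congr (hm _ (by omega))
    have e₂ : s₁.row n (n + 2) = s.row n (n + 2) := Config.row_congr (hm _ (by omega))
    obtain ⟨s₂, h₂, f₂, b₂, m₂, w₂⟩ := reaches_pivotStep (C := C) (s := s₁) (n := n)
      ((hf.reg 0 (by norm_num)).trans hn) hb₁ (by omega) h4.2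
    rw [h2, e₁, e₂] at w₂
    rw [h2] at m₂
    refine ⟨s₂, h₂, (f₂.reg 2 (by norm_num)).trans h2,
      (hf.trans (f₂.mono (by norm_num))).setReg le_rfl,
      (f₂.reg 3 (by norm_num)).trans h3, b₂, fun i hi => ?_, ?_⟩
    · exact (m₂ i (by omega)).trans (hm i (by omega))
    · simp only [Config.setReg_reg, Config.setReg_mem, ne_eq,
        Nat.reduceEqDiff, not_false_eq_true, Function.update_of_ne]
      have er : ∀ i, (s₂.setReg 2 r).row n i = s₂.row n i := fun i => rfl
      simp only [er]
      rcases w₂ with ⟨w0, w4, wm⟩ | ⟨w0, w4, w4', wm⟩ | ⟨w0, w4, w4', wm⟩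
      · rw [w4, wm]
        rcases hd with ⟨d4, dm, dd⟩ | ⟨d4, d4', dm, dp, dd⟩
        · refine .inl ⟨d4, dm, fun i hi hi' => ?_⟩
          rcases Nat.lt_or_eq_of_le (Nat.succ_le_of_lt hi) with h | h
          · exact dd i h hi'
          · rw [← h]; exact w0
        · refine .inr ⟨by omega, d4', dm, dp, fun i hi hi' hne => ?_⟩
          rw [Config.row_congr (s := s₁) (by rw [wm])]
          rcases Nat.lt_or_eq_of_le (Nat.succ_le_of_lt hi) with h | h
          · exact dd i h hi' hne
          · rw [← h, Nat.succ_eq_add_one, w0, zero_smul, add_zero, e₁]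
      · rcases hd with ⟨d4, dm, dd⟩ | ⟨d4, d4', -⟩
        · rw [w4', wm, dm]
          refine .inr ⟨by omega, by omega, rfl, w0, fun i hi hi' hne => ?_⟩
          rw [dd i (by omega) hi', zero_smul, add_zero]
          exact Config.row_congr (by rw [wm, dm])
        · omega
      · rcases hd with ⟨d4, -⟩ | ⟨d4, d4', dm, dp, dd⟩
        · omega
        · rw [w4']
          refine .inr ⟨by omega, d4', by rw [m₂ _ (by omega), dm], dp, fun i hi hi' hne => ?_⟩
          rcases Nat.lt_or_eq_of_le (Nat.succ_le_of_lt hi) with h | h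
          · rw [Config.row_congr (m₂ i (by omega))]
            exact dd i h hi' hne
          · rw [← h, Nat.succ_eq_add_one, w0, one_smul, wm, Config.row_congr dm]
  · refine ⟨((Config.Frame.refl 2 s).setReg (by norm_num)).setReg le_rfl, by simp, hb,
      fun _ _ => rfl, .inl ⟨by simp, rfl, fun i hi hi' => by omega⟩⟩

/-- Update the affine space `row 0 + span (row 1, …, row n)` by the equation whose coefficients are
in row `n + 2` and whose right-hand side is in `reg 3`. -/
def eliminate : Cmd :=
  .seq pivotLoop (.seq (.assign 5 (.reg 3)) (.seq dotRow
    (.seq (.ite (.reg 5) addRow .skip) clearRow)))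

/-- The pivot loop ends with `reg 2 = 0`, so `dotRow` and `addRow` now treat row `0`, with the
right-hand side preloaded as parity. Row `n + 1` is kept zero and serves as the pivot `u = 0` when
there is none. Clearing the pivot row fits the common formula, because `u + 1 • u = 0`. -/
theorem reaches_eliminate (hn : s.reg 0 = n) (hb : s.IsBinary) (h3 : s.reg 3 ≤ 1)
    (hz : s.row n (n + 1) = 0) :
    ∃ s', Reaches C eliminate (n * (n * 10 + 30) + 20) s s' ∧ s.Frame 2 s' ∧
      s'.IsBinary ∧ s'.row n (n + 1) = 0 ∧
      ∃ u : Fin n → ZMod 2,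
        ((∃ p, 1 ≤ p ∧ p ≤ n ∧ u = s.row n p ∧ u ⬝ᵥ s.row n (n + 2) = 1) ∨
          (u = 0 ∧ ∀ i, 1 ≤ i → i ≤ n → s.row n i ⬝ᵥ s.row n (n + 2) = 0)) ∧
        (∀ i, 1 ≤ i → i ≤ n →
          s'.row n i = s.row n i + (s.row n i ⬝ᵥ s.row n (n + 2)) • u) ∧
        s'.row n 0 = s.row n 0 + ((s.reg 3 : ZMod 2) + s.row n 0 ⬝ᵥ s.row n (n + 2)) • u := by
  obtain ⟨s₁, h₁, f₁, r3, r2, b₁, m₁, d₁⟩ := reaches_pivotLoop (C := C) hn hb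
  have r0 : s₁.reg 0 = n := (f₁.reg 0 (by norm_num)).trans hn
  have h4 : 1 ≤ s₁.reg 4 := by rcases d₁ with d | d <;> omega
  have ha : Reaches C (.assign 5 (.reg 3)) 1 s₁ (s₁.setReg 5 (s.reg 3)) := by
    simpa [Config.val, Expr.eval, r3] using Reaches.assign (C := C) s₁ 5 (.reg 3)
  obtain ⟨s₂, h₂, f₂, m₂, b5, d₂⟩ := reaches_dotRow (C := C) (s := s₁.setReg 5 (s.reg 3))
    (n := n) (by simpa using r0) b₁ (by simpa using h3)
  have f₂' : s₁.Frame 5 s₂ := ((Config.Frame.refl 5 s₁).setReg le_rfl).trans f₂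
  have hm₂ : s₂.mem = s₁.mem := m₂
  have b₂ : s₂.IsBinary := by rw [Config.IsBinary, hm₂]; exact b₁
  have q0 : s₂.reg 0 = n := (f₂'.reg 0 (by norm_num)).trans r0
  have q2 : s₂.reg 2 = 0 := (f₂'.reg 2 (by norm_num)).trans r2
  have q4 : s₂.reg 4 = s₁.reg 4 := f₂'.reg 4 (by norm_num)
  have hd : (s₂.reg 5 : ZMod 2) = s.reg 3 + s.row n 0 ⬝ᵥ s.row n (n + 2) := by
    rw [d₂]
    have e₁ : (s₁.setReg 5 (s.reg 3)).row n 0 = s.row n 0 := Config.row_congr (m₁ 0 (by simp))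
    have e₂ : (s₁.setReg 5 (s.reg 3)).row n (n + 2) = s.row n (n + 2) :=
      Config.row_congr (m₁ _ (by omega))
    simp [r2, e₁, e₂]
  obtain ⟨s₃, h₃, f₃, b₃, m₃, w₃⟩ : ∃ s₃, Reaches C (.ite (.reg 5) addRow .skip) (n * 4 + 4) s₂ s₃ ∧
      s₂.Frame 5 s₃ ∧ s₃.IsBinary ∧ (∀ i, i ≠ 0 → s₃.mem i = s₁.mem i) ∧
      s₃.row n 0 = s.row n 0 + ((s.reg 3 : ZMod 2) + s.row n 0 ⬝ᵥ s.row n (n + 2)) •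
        s₁.row n (s₁.reg 4) := by
    rw [← hd]
    by_cases c : s₂.reg 5 = 0
    · refine ⟨s₂, (Reaches.ite_false (e := .reg 5) c (.skip _)).mono (by omega), .refl _ _, b₂,
        fun i _ => by rw [hm₂], ?_⟩
      rw [c, Nat.cast_zero, zero_smul, add_zero]
      exact Config.row_congr (by rw [hm₂, m₁ 0 (by simp)])
    · obtain ⟨s₃, h₃, f₃, b₃, m₃, w₃⟩ := reaches_addRow (C := C) (s := s₂) q0 b₂ (by omega)
      rw [q2, q4] at w₃
      rw [q2] at m₃
      refine ⟨s₃, .ite_true c h₃, f₃, b₃, fun i hi => (m₃ i hi).trans (by rw [hm₂]), ?_⟩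
      have er : ∀ i, s₂.row n i = s₁.row n i := fun i => Config.row_congr (by rw [hm₂])
      rw [w₃, zmod_two_cast_ne_zero b5 c, one_smul, er, er,
        Config.row_congr (m₁ 0 (by simp))]
  have t0 : s₃.reg 0 = n := (f₃.reg 0 (by norm_num)).trans q0
  have t4 : s₃.reg 4 = s₁.reg 4 := (f₃.reg 4 (by norm_num)).trans q4
  obtain ⟨s₄, h₄, f₄, b₄, m₄, w₄⟩ := reaches_clearRow (C := C) (s := s₃) t0 b₃
  rw [t4] at m₄ w₄
  have row_eq : ∀ i, i ≠ 0 → i ≠ s₁.reg 4 → s₄.row n i = s₁.row n i := fun i hi hi' =>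
    Config.row_congr ((m₄ i hi').trans (m₃ i hi))
  have row_zero : s₄.row n 0 = s₃.row n 0 := Config.row_congr (m₄ 0 (by omega))
  refine ⟨s₄, (h₁.seq (ha.seq (h₂.seq (h₃.seq h₄)))).mono (by ring_nf; omega),
    f₁.trans (((f₂'.trans f₃).trans f₄).mono (by norm_num)), b₄, ?_, s₁.row n (s₁.reg 4), ?_, ?_,
    row_zero.trans w₃⟩
  · by_cases h : n + 1 = s₁.reg 4
    · rw [h, w₄]
    · rw [row_eq _ (by omega) h, Config.row_congr (m₁ _ (by omega)), hz]
  · rcases d₁ with ⟨d4, dm, dd⟩ | ⟨d4, d4', dm, dp, dd⟩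
    · right
      rw [d4]
      exact ⟨(Config.row_congr (m₁ _ (by omega))).trans hz, dd⟩
    · left
      have := Config.row_congr (n := n) dm
      exact ⟨s₁.reg 4, d4, d4', this, by rw [this, dp]⟩
  · intro i hi hi'
    rcases d₁ with ⟨d4, dm, dd⟩ | ⟨d4, d4', dm, dp, dd⟩
    · rw [dd i hi hi', zero_smul, add_zero, row_eq i (by omega) (by omega)]
      exact Config.row_congr (by rw [dm])
    · rw [Config.row_congr (n := n) dm]
      by_cases h : i = s₁.reg 4
      · rw [h, w₄, dp, one_smul]
        funext j
        exact (CharTwo.add_self_eq_zero _).symm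
      · rw [row_eq i (by omega) h, dd i hi hi' h]

end Elimination

/-! ### State preparation and readout -/

section Sampling

variable {n : ℕ} {C : Op (n + 1) →ₗ[ℂ] Op (n + 1)} {x : Bits n} {B T : ℕ}
  {s s' : Config (n + 1)} {v : ℝ} {k : List Cmd}

/-! ### The quantum part of the program -/

/-- Reset all qubits to `|+⟩`. -/
def prepare : Cmd :=
  forDown 2 (.add (.reg 0) (.const 1))
    (.seq (.reset (.sub (.reg 2) (.const 1))) (.hGate (.sub (.reg 2) (.const 1))))

/-- A basis state is what the previous round's measurement leaves behind; starting from it, the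
register remains a product state throughout. -/
theorem reaches_prepare (hn : s.reg 0 = n) {w : ℂ} {a : Bits (n + 1)}
    (hρ : s.ρ = w • basisState a) :
    ∃ s', Reaches C prepare ((n + 1) * 6 + 3) s s' ∧ s'.reg 0 = n ∧ s'.reg 1 = s.reg 1 ∧
      s'.mem = s.mem ∧ s'.queries = s.queries ∧ s'.ρ = w • plusState (n + 1) := by
  refine Exists.elim (Reaches.forDown (C := C) (i := 2) (t := 3) (s := s)
    (e := .add (.reg 0) (.const 1)) (N := n + 1)
    (c := .seq (.reset (.sub (.reg 2) (.const 1))) (.hGate (.sub (.reg 2) (.const 1))))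
    (fun r s' => s'.reg 0 = n ∧ s'.reg 1 = s.reg 1 ∧ s'.mem = s.mem ∧ s'.queries = s.queries ∧
      s'.ρ = w • tensor fun q : Fin (n + 1) =>
        if r ≤ q then plusProj else ketbra (a q) (a q))
    (by simp [Config.val, Expr.eval, hn]) ?_ ?_) ?_
  rotate_left 2
  · rintro s' ⟨h, ⟨h0, h1, hm, hq, hd⟩, -⟩
    exact ⟨s', h, h0, h1, hm, hq, by simpa [plusState_eq] using hd⟩
  · rintro r hr s₁ ⟨h0, h1, hm, hq, hd⟩ h2
    have hv : s₁.val (.sub (.reg 2) (.const 1)) = ((⟨r, hr⟩ : Fin (n + 1)) : ℕ) := by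
      simp [Config.val, Expr.eval, h2]
    refine ⟨_, (Reaches.reset _ hv).seq (Reaches.hGate ⟨r, hr⟩ hv), h2, by simpa using h0,
      by simpa using h1, hm, hq, ?_⟩
    have hs : ∀ (A : Fin 2 → Op (n + 1)) (ρ : Op (n + 1)),
        ∑ b, conjBy (A b) (w • ρ) = w • ∑ b, conjBy (A b) ρ := fun A ρ => by
      simp [conjBy_smul]
    simp only [Config.setReg_ρ, Config.setState_ρ, hd]
    rw [hs, reset_basis _ (a ⟨r, hr⟩) _ (by simp), conjBy_smul, conjBy_onQubit_tensor]
    congr 2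
    funext q
    by_cases h : q = ⟨r, hr⟩
    · subst h
      simp [hadamard_zero]
    · have h' : (q : ℕ) ≠ r := fun e => h (Fin.ext e)
      simp only [Function.update_of_ne h]
      by_cases hrq : r ≤ q
      · rw [if_pos (by omega), if_pos hrq]
      · rw [if_neg (by omega), if_neg hrq]
  · refine ⟨by simpa using hn, by simp, rfl, rfl, ?_⟩
    rw [Config.setReg_ρ, hρ, basisState]
    congr 2
    funext q
    rw [if_neg (by omega)]

theorem Wins.seq {c₁ c₂ : Cmd} (h : Wins C x B T (s.withCode (c₁ :: c₂ :: k)) v) :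
    Wins C x B (T + 1) (s.withCode (.seq c₁ c₂ :: k)) v :=
  .of_run (s' := s.withCode (c₁ :: c₂ :: k)) (by simp [run, step]; rfl) h

theorem Wins.loop_true {e : Expr} {c : Cmd} (he : s.val e ≠ 0)
    (h : Wins C x B T (s.withCode (c :: .loop e c :: k)) v) :
    Wins C x B (T + 1) (s.withCode (.loop e c :: k)) v :=
  .of_run (by simp [run, step_loop_true he]) h

theorem Wins.loop_false {e : Expr} {c : Cmd} (he : s.val e = 0)
    (h : Wins C x B T (s.withCode k) v) : Wins C x B (T + 1) (s.withCode (.loop e c :: k)) v :=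
  .of_run (by simp [run, step_loop_false he]) h

/-- Measure a qubit in the Hadamard basis. -/
def measureX (i : ℕ) (e : Expr) : Cmd := .seq (.hGate e) (.measure i e)

theorem wins_measureX {i : ℕ} {e : Expr} (q : Fin (n + 1)) (hq : s.val e = q) {V : Fin 2 → ℝ}
    (h : ∀ b : Fin 2, Wins C x B T (((s.setReg i (b : ℕ)).setState
      (conjBy (onQubit q (measOp b)) s.ρ)).withCode k) (V b)) :
    Wins C x B (T + 3) (s.withCode (measureX i e :: k)) (∑ b, V b) := by
  refine Wins.seq (T := T + 1 + 1) (Reaches.wins (Reaches.hGate q hq) ?_)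
  set s₁ := s.setState (conjBy (onQubit q hadamard) s.ρ)
  have h' : (s₁.withCode (.measure i e :: k)).val e = q := hq
  have hlt : (s₁.withCode (.measure i e :: k)).val e < n + 1 := h' ▸ q.isLt
  have hq' : (⟨_, hlt⟩ : Fin (n + 1)) = q := Fin.ext h'
  have key : ∀ b, conjBy (onQubit q (ketbra b b)) s₁.ρ = conjBy (onQubit q (measOp b)) s.ρ := by
    intro b
    rw [Config.setState_ρ, conjBy_conjBy]
    congr 1
    rw [onQubit, onQubit, onQubit, tensor_mul]
    congr 1
    funext j
    by_cases hj : j = q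
    · subst hj; simp [measOp]
    · simp [hj]
  rw [Fin.sum_univ_two]
  refine Wins.branch ?_ (h 0) (h 1)
  simp only [step, Config.withCode_code, hlt, dite_true, hq', List.map_cons, List.map_nil,
    Config.withCode_ρ, key]
  rfl

/-- Measure qubit `reg 2` and store the outcome in row `n + 2`. -/
def readStep : Cmd :=
  .seq (measureX 4 (.reg 2))
    (.store (.add (.reg 0) (.const 2)) (.sub (.reg 2) (.const 1)) (.reg 4))

/-- Measure all qubits in the Hadamard basis: qubit `0` into `reg 3`, the others into row
`n + 2`. -/
def readout : Cmd := .seq (measureX 3 (.const 0)) (forDown 2 (.reg 0) readStep)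

/-- `s` arises from `s₀` when the qubits `0` and `r + 1, …, n` have been read out, with outcomes
`b` and `y`. -/
structure IsReadout (s₀ : Config (n + 1)) (b : Fin 2) (r : ℕ) (y : Bits n)
    (s : Config (n + 1)) : Prop where
  reg_zero : s.reg 0 = n
  reg_one : s.reg 1 = s₀.reg 1
  reg_three : s.reg 3 = (b : ℕ)
  queries : s.queries = s₀.queries
  isBinary : s.IsBinary
  mem : ∀ i, i ≠ n + 2 → s.mem i = s₀.mem i
  outcome : ∀ j : Fin n, r ≤ j → s.mem (n + 2) j = (y j : ℕ)
  ρ : s.ρ = conjBy (tensor (Fin.cons (measOp b) fun j : Fin n =>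
    if r ≤ j then measOp (y j) else 1)) s₀.ρ

/-- The value is the sum over all completions of the bits already read; only the entries of `y` from
`r` on matter. -/
theorem wins_readLoop {s₀ : Config (n + 1)} {b : Fin 2} {V : Bits n → ℝ} {r : ℕ} (hr : r ≤ n)
    {y : Bits n} (hs : IsReadout s₀ b r y s) (h2 : s.reg 2 = r)
    (h : ∀ y' s', IsReadout s₀ b 0 y' s' → Wins C x B T (s'.withCode k) (V y')) :
    Wins C x B (T + (r * 8 + 1)) (s.withCode (countdown 2 readStep :: k))
      (∑ y' : Bits n with ∀ j : Fin n, r ≤ j → y' j = y j, V y') := by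
  induction r generalizing s y with
  | zero =>
    have : (Finset.univ.filter fun y' : Bits n => ∀ j : Fin n, 0 ≤ (j : ℕ) → y' j = y j) = {y} := by
      ext y'
      simp [funext_iff]
    rw [this, Finset.sum_singleton]
    exact (Wins.loop_false (e := .reg 2) h2 (h y s hs)).mono (by omega) le_rfl
  | succ r ih =>
    have hrn : r < n := hr
    have hv : s.val (.reg 2) = ((Fin.succ ⟨r, hrn⟩ : Fin (n + 1)) : ℕ) := h2
    -- The completions split according to the bit read next.
    have hsum : (∑ y' : Bits n with ∀ j : Fin n, r + 1 ≤ j → y' j = y j, V y') =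
        ∑ b' : Fin 2, ∑ y' : Bits n with ∀ j : Fin n, r ≤ j →
          y' j = Function.update y ⟨r, hrn⟩ b' j, V y' := by
      rw [← Finset.sum_fiberwise _ (fun y' : Bits n => y' ⟨r, hrn⟩)]
      refine Finset.sum_congr rfl fun b' _ => ?_
      rw [Finset.filter_filter]
      congr 1
      ext y'
      simp only [Finset.mem_filter, Finset.mem_univ, true_and]
      constructor
      · rintro ⟨h1, h2⟩ j hj
        by_cases e : j = ⟨r, hrn⟩
        · subst e; simpa using h2
        · rw [Function.update_of_ne e]
          exact h1 j (by have : (j : ℕ) ≠ r := fun e' => e (Fin.ext e')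
                         omega)
      · intro h1
        refine ⟨fun j hj => ?_, by simpa using h1 ⟨r, hrn⟩ le_rfl⟩
        have := h1 j (by omega)
        rwa [Function.update_of_ne (by rintro rfl; simp at hj)] at this
    rw [hsum]
    refine Wins.mono (T := T + (r * 8 + 1) + 1 + 1 + 3 + 1 + 1 + 1) ?_ (by omega) le_rfl
    refine Wins.loop_true (by rw [hv]; simp) (Wins.seq (Wins.seq (wins_measureX _ hv fun b' => ?_)))
    refine Reaches.wins (T := T + (r * 8 + 1) + 1) (Reaches.store _ _ _ _)
      (Reaches.wins (T := T + (r * 8 + 1)) (Reaches.assign _ _ _) ?_)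
    refine ih (by omega) (y := Function.update y ⟨r, hrn⟩ b') ?_ ?_
    · have hb' : (b' : ℕ) ≤ 1 := by omega
      have r0 := hs.reg_zero
      constructor
      · simpa using hs.reg_zero
      · simpa using hs.reg_one
      · simpa using hs.reg_three
      · exact hs.queries
      · intro i j
        have := hs.isBinary i j
        have := hs.isBinary (n + 2) j
        simp only [Config.setReg_mem, Config.setMem_mem, Config.val, Expr.eval, Config.setState_mem,
          Config.setState_reg, Config.setReg_reg, Function.update_apply, ite_apply]
        split_ifs <;> simp_all
      · intro i hi
        simp only [Config.setReg_mem, Config.setMem_mem, Config.val, Expr.eval, Config.setState_mem,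
          Config.setState_reg, Config.setReg_reg]
        rw [Function.update_of_ne (by simpa [r0] using hi), hs.mem i hi]
      · intro j hj
        simp only [Config.setReg_mem, Config.setMem_mem, Config.val, Expr.eval, Config.setState_mem,
          Config.setState_reg, Config.setReg_reg]
        by_cases e : j = ⟨r, hrn⟩
        · subst e
          simp [r0, h2]
        · have e' : (j : ℕ) ≠ r := fun e' => e (Fin.ext e')
          simp [r0, h2, e, e', hs.outcome j (by omega)]
      · simp only [Config.setReg_ρ, Config.setMem_ρ, Config.setState_ρ, hs.ρ]
        rw [conjBy_conjBy, onQubit_mul_tensor]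
        congr 2
        rw [← Fin.cons_update]
        congr 1
        funext j
        by_cases e : j = ⟨r, hrn⟩
        · subst e
          simp [-Fin.succ_mk]
        · have e' : (j : ℕ) ≠ r := fun e' => e (Fin.ext e')
          have : r + 1 ≤ j ↔ r ≤ j := by omega
          simp only [Function.update_of_ne e, this]
    · simp [Config.val, Expr.eval, h2]

theorem wins_readout {V : Fin 2 → Bits n → ℝ} (hn : s.reg 0 = n) (hb : s.IsBinary)
    (h : ∀ b y s', IsReadout s b 0 y s' → Wins C x B T (s'.withCode k) (V b y)) :
    Wins C x B (T + (n * 8 + 7)) (s.withCode (readout :: k)) (∑ b, ∑ y, V b y) := by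
  refine Wins.mono (T := T + (n * 8 + 1) + 1 + 1 + 3 + 1) ?_ (by omega) le_rfl
  refine Wins.seq (wins_measureX 0 rfl fun b => Wins.seq (Reaches.wins (Reaches.assign _ _ _) ?_))
  refine (wins_readLoop (s₀ := s) (b := b) (y := 0) (V := V b) le_rfl ?_ ?_ (h b)).mono le_rfl
    (le_of_eq ?_)
  · constructor
    · simpa using hn
    · simp
    · simp
    · rfl
    · exact hb
    · exact fun _ _ => rfl
    · intro j hj
      omega
    · simp only [Config.setReg_ρ, Config.setState_ρ, onQubit]
      congr 2
      funext q
      refine Fin.cases ?_ (fun j => ?_) q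
      · simp
      · simp
  · simpa [Config.val, Expr.eval] using hn
  · refine Finset.sum_congr ?_ fun _ _ => rfl
    ext y
    simp only [Finset.mem_filter, Finset.mem_univ, true_and, true_iff]
    intro j hj
    omega

theorem IsReadout.ρ_eq {s₀ : Config (n + 1)} {b : Fin 2} {y : Bits n}
    (h : IsReadout s₀ b 0 y s) : s.ρ = fullMeas (Fin.cons b y : Bits (n + 1)) s₀.ρ := by
  rw [h.ρ, fullMeas]
  congr 2
  funext q
  refine Fin.cases ?_ (fun j => ?_) q <;> simp

theorem IsReadout.row_eq {s₀ : Config (n + 1)} {b : Fin 2} {y : Bits n}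
    (h : IsReadout s₀ b 0 y s) : s.row n (n + 2) = vec y := by
  funext j
  simp [Config.row, vec, h.outcome j (Nat.zero_le _)]

end Sampling

/-! ### Decay of the expected number of wrong candidates -/

section Counting

variable {n : ℕ}

/-! ### The expected number of remaining candidates -/

theorem vec_injective : Function.Injective (vec : Bits n → Fin n → ZMod 2) := by
  intro a b h
  funext j
  have h' : ∀ u w : Fin 2, ((u : ℕ) : ZMod 2) = ((w : ℕ) : ZMod 2) → u = w := by decide
  exact h' _ _ (congrFun h j)

/-- Flipping bit `j` of `y`, where `z` and `t` differ at `j`, is an involution that exchanges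
agreement and disagreement of the two products. -/
theorem two_mul_card_dotProduct_eq {z t : Fin n → ZMod 2} (h : z ≠ t) :
    2 * (Finset.univ.filter fun y : Bits n => z ⬝ᵥ vec y = t ⬝ᵥ vec y).card = 2 ^ n := by
  obtain ⟨j, hj⟩ := Function.ne_iff.1 h
  have hadd : ∀ u : Fin 2, u + 1 + 1 = u := by decide
  have hcast : ∀ u : Fin 2, (((u + 1 : Fin 2) : ℕ) : ZMod 2) = ((u : ℕ) : ZMod 2) + 1 := by decide
  have hz : ∀ a b : ZMod 2, a ≠ b → a = b + 1 := by decide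
  have hne : ∀ a b c : ZMod 2, (a + (b + 1) = c + b ↔ ¬ a = c) := by decide
  let f : Bits n → Bits n := fun y => Function.update y j (y j + 1)
  have hf : Function.Involutive f := fun y => by simp [f, hadd]
  have hv : ∀ y, vec (f y) = vec y + Pi.single j 1 := by
    intro y
    funext i
    by_cases hi : i = j
    · subst hi; simp [f, vec, hcast]
    · simp [f, vec, hi]
  have key : ∀ y, z ⬝ᵥ vec (f y) = t ⬝ᵥ vec (f y) ↔ ¬ z ⬝ᵥ vec y = t ⬝ᵥ vec y := by
    intro y
    rw [hv, dotProduct_add, dotProduct_add, dotProduct_single, dotProduct_single, mul_one, mul_one,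
      hz _ _ hj, hne]
  have hcard : (Finset.univ.filter fun y : Bits n => z ⬝ᵥ vec y = t ⬝ᵥ vec y).card =
      (Finset.univ.filter fun y : Bits n => ¬ z ⬝ᵥ vec y = t ⬝ᵥ vec y).card :=
    Finset.card_equiv hf.toPerm fun y => by
      simp only [Finset.mem_filter, Finset.mem_univ, true_and, Function.Involutive.coe_toPerm, key,
        not_not]
  have htot := Finset.card_filter_add_card_filter_not (s := (Finset.univ : Finset (Bits n)))
    (fun y => z ⬝ᵥ vec y = t ⬝ᵥ vec y)
  rw [← hcard] at htot
  rw [two_mul, htot]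
  simp

/-- Double counting: `t` survives every `y`, each other candidate exactly half of them. -/
theorem sum_card_filter_dotProduct {t : Fin n → ZMod 2} {S : Finset (Fin n → ZMod 2)}
    (ht : t ∈ S) :
    ∑ y : Bits n, ((S.filter fun z => z ⬝ᵥ vec y = t ⬝ᵥ vec y).card : ℝ) =
      2 ^ n * ((S.card : ℝ) + 1) / 2 := by
  have h1 : ∀ z ∈ S.erase t, ((Finset.univ.filter fun y : Bits n =>
      z ⬝ᵥ vec y = t ⬝ᵥ vec y).card : ℝ) = 2 ^ n / 2 := by
    intro z hz
    have := two_mul_card_dotProduct_eq (Finset.ne_of_mem_erase hz)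
    have h : (2 : ℝ) * ((Finset.univ.filter fun y : Bits n =>
      z ⬝ᵥ vec y = t ⬝ᵥ vec y).card : ℝ) = 2 ^ n := by exact_mod_cast this
    linarith
  have h2 : ∑ y : Bits n, ((S.filter fun z => z ⬝ᵥ vec y = t ⬝ᵥ vec y).card : ℝ) =
      ∑ z ∈ S, ((Finset.univ.filter fun y : Bits n => z ⬝ᵥ vec y = t ⬝ᵥ vec y).card : ℝ) := by
    simp only [Finset.card_filter, Nat.cast_sum]
    exact Finset.sum_comm
  rw [h2, ← Finset.add_sum_erase S _ ht, Finset.sum_congr rfl h1, Finset.sum_const,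
    Finset.card_erase_of_mem ht, nsmul_eq_mul, Nat.cast_sub (Finset.card_pos.2 ⟨t, ht⟩)]
  simp
  ring

/-- The candidates that remain after the outcome `(b, y)`; outcomes that contradict the target are
disregarded. -/
def remaining (x : Bits n) (S : Finset (Fin n → ZMod 2)) (b : Fin 2) (y : Bits n) :
    Finset (Fin n → ZMod 2) :=
  if ((b : ℕ) : ZMod 2) = vec x ⬝ᵥ vec y then S.filter fun z => z ⬝ᵥ vec y = vec x ⬝ᵥ vec y else S

theorem outcomeProb_nonneg (x : Bits n) (b : Fin 2) (y : Bits n) : 0 ≤ outcomeProb x b y := by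
  rw [outcomeProb]
  positivity

/-- The uninformative outcome (weight 1/3) keeps `|S| - 1`, an informative one (weight 2/3) halves
it on average: `1/3 + 2/3 · 1/2 = 2/3`. The value is affine in `|S|`, so only this expectation
matters. -/
theorem sum_outcomeProb {x : Bits n} {S : Finset (Fin n → ZMod 2)} (hx : vec x ∈ S) (μ : ℝ) :
    ∑ b, ∑ y, outcomeProb x b y * (1 - (((remaining x S b y).card : ℝ) - 1) * μ) =
      1 - ((S.card : ℝ) - 1) * (2 / 3 * μ) := by
  have hterm : ∀ (b : Fin 2) (y : Bits n),
      outcomeProb x b y * (1 - (((remaining x S b y).card : ℝ) - 1) * μ) =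
        1 / 3 * (1 - ((S.card : ℝ) - 1) * μ) * (if b = 1 ∧ vec y = 0 then 1 else 0) +
        2 / 3 * ((2 : ℝ) ^ n)⁻¹ *
          (1 - (((S.filter fun z => z ⬝ᵥ vec y = vec x ⬝ᵥ vec y).card : ℝ) - 1) * μ) *
          (if ((b : ℕ) : ZMod 2) = vec x ⬝ᵥ vec y then 1 else 0) := by
    intro b y
    rw [outcomeProb, remaining]
    by_cases h : ((b : ℕ) : ZMod 2) = vec x ⬝ᵥ vec y
    -- The two parts of the law have disjoint supports: `(1, 0)` contradicts every target.
    · have h' : ¬ (b = 1 ∧ vec y = 0) := by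
        rintro ⟨rfl, hy⟩
        simp [hy] at h
      simp [h, h']
    · simp only [if_neg h]
      ring
  have hb : ∀ d : ZMod 2, ∑ b : Fin 2, (if ((b : ℕ) : ZMod 2) = d then (1 : ℝ) else 0) = 1 := by
    intro d
    have hd : d = 0 ∨ d = 1 := by revert d; decide
    rw [Fin.sum_univ_two]
    rcases hd with rfl | rfl <;> simp
  have h0 : ∑ y : Bits n, (if vec y = 0 then (1 : ℝ) else 0) = 1 := by
    have : ∀ y : Bits n, vec y = 0 ↔ y = 0 := fun y =>
      ⟨fun h => vec_injective (h.trans (by funext j; simp [vec])), fun h => by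
        subst h; funext j; simp [vec]⟩
    simp [this]
  have hp : (2 : ℝ) ^ n ≠ 0 := by positivity
  rw [Finset.sum_comm]
  simp only [hterm, Finset.sum_add_distrib, ← Finset.mul_sum, hb, mul_one]
  have h1 : ∀ y : Bits n, ∑ b : Fin 2, (if b = 1 ∧ vec y = 0 then (1 : ℝ) else 0) =
      if vec y = 0 then 1 else 0 := fun y => by rw [Fin.sum_univ_two]; simp
  simp only [h1, h0, Finset.sum_sub_distrib, ← Finset.sum_mul, sum_card_filter_dotProduct hx]
  simp
  field_simp
  ring

end Counting

/-! ### The invariant of the search and the success probability -/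

section Search

variable {n : ℕ} {C : Op (n + 1) →ₗ[ℂ] Op (n + 1)} {x : Bits n} {B T : ℕ}
  {s s' : Config (n + 1)} {v : ℝ} {k : List Cmd}

/-! ### The search -/

/-- An element of the affine space `row 0 + span (row 1, …, row n)`. -/
def Config.affine (s : Config (n + 1)) (c : Fin n → ZMod 2) : Fin n → ZMod 2 :=
  s.row n 0 + ∑ i : Fin n, c i • s.row n (i + 1)

/-- The affine space of `s` lies in `S` and contains the target. -/
structure Config.Tracks (s : Config (n + 1)) (x : Bits n) (S : Finset (Fin n → ZMod 2)) :
    Prop where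
  subset : ∀ c, s.affine c ∈ S
  target : ∃ c, s.affine c = vec x

/-- In fixed coordinates `c`, elimination acts on points as the affine map `z ↦ z + (b + z·y) u`. -/
theorem affine_update {y u : Fin n → ZMod 2} {b : ZMod 2}
    (hi : ∀ i, 1 ≤ i → i ≤ n → s'.row n i = s.row n i + (s.row n i ⬝ᵥ y) • u)
    (h0 : s'.row n 0 = s.row n 0 + (b + s.row n 0 ⬝ᵥ y) • u) (c : Fin n → ZMod 2) :
    s'.affine c = s.affine c + (b + s.affine c ⬝ᵥ y) • u := by
  have h : ∀ i : Fin n, s'.row n (i + 1) = s.row n (i + 1) + (s.row n (i + 1) ⬝ᵥ y) • u :=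
    fun i => hi _ (by omega) (by omega)
  simp only [Config.affine, h, h0, add_dotProduct, sum_dotProduct, smul_dotProduct, smul_add,
    Finset.sum_add_distrib, smul_eq_mul, add_smul, Finset.sum_smul, mul_smul]
  abel

theorem affine_add_single (c : Fin n → ZMod 2) (p : Fin n) (e : ZMod 2) :
    s.affine (c + Pi.single p e) = s.affine c + e • s.row n (p + 1) := by
  simp only [Config.affine, Pi.add_apply, add_smul, Finset.sum_add_distrib, ← add_assoc]
  congr 1
  rw [Finset.sum_eq_single p]
  · simp
  · intro i _ hi
    simp [hi]
  · simp

/-- If `u·y = 1`, this map projects onto the hyperplane `z·y = b` along `u`, a direction of the old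
space, and fixes the target. If there is no pivot, all points have the same product with `y` as the
target, so the equation holds already. -/
theorem Config.Tracks.update {S : Finset (Fin n → ZMod 2)} {y u : Fin n → ZMod 2} {b : ZMod 2}
    (h : s.Tracks x S) (hb : b = vec x ⬝ᵥ y)
    (hu : (∃ p, 1 ≤ p ∧ p ≤ n ∧ u = s.row n p ∧ u ⬝ᵥ y = 1) ∨
      (u = 0 ∧ ∀ i, 1 ≤ i → i ≤ n → s.row n i ⬝ᵥ y = 0))
    (hi : ∀ i, 1 ≤ i → i ≤ n → s'.row n i = s.row n i + (s.row n i ⬝ᵥ y) • u)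
    (h0 : s'.row n 0 = s.row n 0 + (b + s.row n 0 ⬝ᵥ y) • u) :
    s'.Tracks x (S.filter fun z => z ⬝ᵥ y = vec x ⬝ᵥ y) := by
  have haff := affine_update hi h0
  obtain ⟨cx, hcx⟩ := h.target
  refine ⟨fun c => ?_, cx, ?_⟩
  · rw [haff, Finset.mem_filter]
    rcases hu with ⟨p, hp, hp', rfl, hy⟩ | ⟨rfl, hy⟩
    · constructor
      · have := h.subset (c + Pi.single ⟨p - 1, by omega⟩ (b + s.affine c ⬝ᵥ y))
        rw [affine_add_single] at this
        simpa [Nat.sub_add_cancel hp] using this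
      · rw [add_dotProduct, smul_dotProduct, hy, smul_eq_mul, mul_one, add_comm, add_assoc,
          CharTwo.add_self_eq_zero, add_zero, hb]
    · have hdot : ∀ c, s.affine c ⬝ᵥ y = s.row n 0 ⬝ᵥ y := by
        intro c
        rw [Config.affine, add_dotProduct, sum_dotProduct, Finset.sum_eq_zero, add_zero]
        intro i _
        rw [smul_dotProduct, hy _ (by omega) (by omega), smul_zero]
      rw [smul_zero, add_zero]
      exact ⟨h.subset c, by rw [hdot, ← hcx, hdot]⟩
  · rw [haff, hcx, hb, CharTwo.add_self_eq_zero, zero_smul, add_zero]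

/-- No row has odd product with `y = 0`, so there is no pivot and the space is unchanged whatever
`b` is. This makes the outcome `(1, 0)` harmless. -/
theorem Config.Tracks.update_zero {S : Finset (Fin n → ZMod 2)} {u : Fin n → ZMod 2} {b : ZMod 2}
    (h : s.Tracks x S) (hu : (∃ p, 1 ≤ p ∧ p ≤ n ∧ u = s.row n p ∧ u ⬝ᵥ 0 = 1) ∨ u = 0)
    (hi : ∀ i, 1 ≤ i → i ≤ n → s'.row n i = s.row n i + (s.row n i ⬝ᵥ 0) • u)
    (h0 : s'.row n 0 = s.row n 0 + (b + s.row n 0 ⬝ᵥ 0) • u) : s'.Tracks x S := by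
  have haff := affine_update hi h0
  have hu' : u = 0 := by
    rcases hu with ⟨p, -, -, -, hp⟩ | hu
    · simp at hp
    · exact hu
  simp only [hu', smul_zero, add_zero] at haff
  exact ⟨fun c => haff c ▸ h.subset c, h.target.imp fun c hc => (haff c).trans hc⟩

/-- The state between two rounds of the search: the candidate set is `S`, and the path has
probability `w`. -/
structure Config.Ready (s : Config (n + 1)) (x : Bits n) (S : Finset (Fin n → ZMod 2)) (w : ℝ) :
    Prop where
  reg_zero : s.reg 0 = n
  isBinary : s.IsBinary
  row_zero : s.row n (n + 1) = 0
  nonneg : 0 ≤ w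
  mem : vec x ∈ S
  ρ : ∃ a, s.ρ = (w : ℂ) • basisState a
  tracks : w = 0 ∨ s.Tracks x S

/-- One round of the search. -/
def round : Cmd := .seq prepare (.seq .query (.seq readout eliminate))

/-- A bound for the number of steps of one round, including the control of the loop. -/
def roundTime (n : ℕ) : ℕ := n * (n * 10 + 44) + 60

theorem Reaches.query (s : Config (n + 1)) :
    Reaches C .query 1 s { s with ρ := C s.ρ, queries := s.queries + 1 } := .of_step fun _ => rfl

theorem wins_round (hC : ∀ b y, fullMeas (Fin.cons b y : Bits (n + 1)) (C (plusState (n + 1))) =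
      (outcomeProb x b y : ℂ) • basisState (Fin.cons b y : Bits (n + 1)))
    {S : Finset (Fin n → ZMod 2)} {w : ℝ} (hs : s.Ready x S w) {V : Fin 2 → Bits n → ℝ}
    (h : ∀ b y (s' : Config (n + 1)), s'.Ready x (remaining x S b y) (w * outcomeProb x b y) →
      s'.reg 1 = s.reg 1 → s'.queries = s.queries + 1 → Wins C x B T (s'.withCode k) (V b y)) :
    Wins C x B (T + (n * (n * 10 + 44) + 48)) (s.withCode (round :: k)) (∑ b, ∑ y, V b y) := by
  obtain ⟨a, ha⟩ := hs.ρ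
  obtain ⟨s₁, h₁, r0, r1, hm, hq, hρ⟩ := reaches_prepare (C := C) hs.reg_zero ha
  refine Wins.mono (T := T + (n * (n * 10 + 30) + 20) + (n * 8 + 7) + 1 + 1 + 1 +
    ((n + 1) * 6 + 3) + 1) ?_ (by ring_nf; omega) le_rfl
  refine Wins.seq (h₁.wins (Wins.seq (Reaches.wins
    (T := T + (n * (n * 10 + 30) + 20) + (n * 8 + 7) + 1) (Reaches.query _) (Wins.seq ?_))))
  have hb₁ : s₁.IsBinary := by rw [Config.IsBinary, hm]; exact hs.isBinary
  refine wins_readout (by exact r0) (by exact hb₁) fun b y s₂ h₂ => ?_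
  have m₂ : ∀ i, i ≠ n + 2 → s₂.mem i = s.mem i := fun i hi =>
    (h₂.mem i hi).trans (congrFun hm i)
  have w₂ : ∀ i, i ≠ n + 2 → s₂.row n i = s.row n i := fun i hi => Config.row_congr (m₂ i hi)
  have hy := h₂.row_eq
  obtain ⟨s₃, h₃, f₃, b₃, z₃, u, hu, hi, h0⟩ := reaches_eliminate (C := C) h₂.reg_zero h₂.isBinary
    (by rw [h₂.reg_three]; omega) (by rw [w₂ _ (by omega), hs.row_zero])
  refine h₃.wins (h b y s₃ ?_ ?_ ?_)
  · rw [hy, h₂.reg_three] at h0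
    rw [hy] at hu hi
    refine ⟨(f₃.reg 0 (by norm_num)).trans h₂.reg_zero, b₃, z₃,
      mul_nonneg hs.nonneg (outcomeProb_nonneg x b y), ?_, ⟨Fin.cons b y, ?_⟩, ?_⟩
    · rw [remaining]
      split_ifs
      · exact Finset.mem_filter.2 ⟨hs.mem, rfl⟩
      · exact hs.mem
    · rw [f₃.ρ, h₂.ρ_eq]
      change fullMeas _ (C s₁.ρ) = _
      rw [hρ, map_smul, fullMeas, conjBy_smul, ← fullMeas, hC, smul_smul]
      push_cast
      rfl
    · rcases hs.tracks with hw | ht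
      · left; rw [hw, zero_mul]
      · have ht₂ : s₂.Tracks x S := by
          have e : ∀ c, s₂.affine c = s.affine c := fun c => by
            simp only [Config.affine]
            rw [w₂ 0 (by omega)]
            congr 1
            exact Finset.sum_congr rfl fun i _ => by rw [w₂ _ (by omega)]
          exact ⟨fun c => e c ▸ ht.subset c, ht.target.imp fun c hc => (e c).trans hc⟩
        rw [remaining]
        split_ifs with hc
        · exact .inr (ht₂.update hc hu hi h0)
        -- A contradictory outcome either has `y = 0` and changes nothing, or has probability zero,
        -- and then the invariant claims nothing.
        · by_cases hy0 : vec y = 0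
          · right
            rw [hy0] at hu hi h0
            exact ht₂.update_zero (hu.imp_right And.left) hi h0
          · left
            simp [outcomeProb, hc, hy0]
  · exact ((f₃.reg 1 (by norm_num)).trans h₂.reg_one).trans r1
  · rw [f₃.queries, h₂.queries, ← hq]

theorem payoff_of_outputs (h : Outputs s x) : payoff x (s.withCode []) = s.ρ.trace.re :=
  if_pos ⟨rfl, h⟩

theorem payoff_nonneg (h : 0 ≤ s.ρ.trace.re) : 0 ≤ payoff x s := by
  rw [payoff]
  split_ifs
  · exact h
  · exact le_rfl

theorem zmod_two_cast_inj {a b : ℕ} (ha : a ≤ 1) (hb : b ≤ 1) (h : (a : ZMod 2) = b) : a = b := by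
  interval_cases a <;> interval_cases b <;> simp_all

/-- Markov's inequality on one path: for `|S| ≥ 2` the bound is not positive, and for `|S| = 1` row
`0`, the point with `c = 0`, must be the target. -/
theorem Config.Ready.le_payoff {S : Finset (Fin n → ZMod 2)} {w : ℝ} (hs : s.Ready x S w) :
    w * (1 - ((S.card : ℝ) - 1)) ≤ payoff x (s.withCode []) := by
  obtain ⟨a, ha⟩ := hs.ρ
  have htr : s.ρ.trace.re = w := by rw [ha, Matrix.trace_smul, trace_basisState]; simp
  have hpos : 0 ≤ payoff x (s.withCode []) := payoff_nonneg (by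
    rw [Config.withCode_ρ, htr]; exact hs.nonneg)
  have hcard : 1 ≤ S.card := Finset.card_pos.2 ⟨_, hs.mem⟩
  rcases hs.tracks with rfl | ht
  · simpa using hpos
  · rcases Nat.lt_or_eq_of_le hcard with h | h
    · have h2 : (2 : ℝ) ≤ S.card := by exact_mod_cast h
      exact (mul_nonpos_of_nonneg_of_nonpos hs.nonneg (by linarith)).trans hpos
    · obtain ⟨z, hz⟩ := Finset.card_eq_one.1 h.symm
      have h0 := ht.subset 0
      have hx := hs.mem
      rw [hz, Finset.mem_singleton] at h0 hx
      have hrow : s.row n 0 = vec x := by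
        rw [hx, ← h0]
        simp [Config.affine]
      rw [payoff_of_outputs fun j =>
        zmod_two_cast_inj (hs.isBinary 0 j) (by omega) (congrFun hrow j), htr, ← h]
      simp

/-- Backward induction on the rounds left, for all `S` and `w`; `sum_outcomeProb` with `μ = (2/3)^i`
says that the claimed value equals the sum of the values after one more round. -/
theorem wins_rounds (hC : ∀ b y, fullMeas (Fin.cons b y : Bits (n + 1)) (C (plusState (n + 1))) =
      (outcomeProb x b y : ℂ) • basisState (Fin.cons b y : Bits (n + 1))) (i : ℕ)
    {S : Finset (Fin n → ZMod 2)} {w : ℝ} (hs : s.Ready x S w) (hi : s.reg 1 = i)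
    (hB : s.queries + i ≤ B) :
    Wins C x B (i * roundTime n + 1) (s.withCode [countdown 1 round])
      (w * (1 - ((S.card : ℝ) - 1) * (2 / 3) ^ i)) := by
  induction i generalizing s S w with
  | zero =>
    refine (Wins.loop_false (T := 0) (e := .reg 1) hi (Wins.of_halted rfl hB ?_)).mono
      (by omega) le_rfl
    simpa using hs.le_payoff
  | succ i ih =>
    have hsum := sum_outcomeProb hs.mem ((2 / 3 : ℝ) ^ i)
    have hval : w * (1 - ((S.card : ℝ) - 1) * (2 / 3) ^ (i + 1)) =
        ∑ b, ∑ y, (w * outcomeProb x b y) *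
          (1 - (((remaining x S b y).card : ℝ) - 1) * (2 / 3) ^ i) := by
      rw [pow_succ, mul_comm ((2 / 3 : ℝ) ^ i), ← hsum, Finset.mul_sum]
      simp only [Finset.mul_sum, mul_assoc]
    rw [hval]
    refine Wins.mono (T := i * roundTime n + 1 + 1 + (n * (n * 10 + 44) + 48) + 1 + 1) ?_
      (by rw [Nat.succ_mul]; simp only [roundTime]; omega) le_rfl
    refine Wins.loop_true (e := .reg 1) (by simp [Config.val, Expr.eval, hi])
      (Wins.seq (wins_round hC hs fun b y s' h' h1 hq => ?_))
    refine Reaches.wins (Reaches.assign _ _ _) ?_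
    have hv : s'.val (.sub (.reg 1) (.const 1)) = i := by simp [Config.val, Expr.eval, h1, hi]
    rw [hv]
    refine ih (s := s'.setReg 1 i) ?_ (by simp) (by rw [Config.setReg_queries, hq]; omega)
    exact ⟨by simpa using h'.reg_zero, h'.isBinary, h'.row_zero, h'.nonneg, h'.mem, h'.ρ,
      h'.tracks.imp_right fun t => ⟨t.subset, t.target⟩⟩

/-- Make the rows `1, …, n` the standard basis. -/
def initRows : Cmd :=
  forDown 2 (.reg 0) (.store (.reg 2) (.sub (.reg 2) (.const 1)) (.const 1))

theorem reaches_initRows (hn : s.reg 0 = n) (hm : s.mem = fun _ _ => 0) :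
    ∃ s', Reaches C initRows (n * 4 + 3) s s' ∧ s.Frame 2 s' ∧
      s'.mem = fun i j => if 1 ≤ i ∧ i ≤ n ∧ j + 1 = i then 1 else 0 := by
  refine Exists.elim (Reaches.forDown (C := C) (i := 2) (t := 1) (s := s)
    (e := .reg 0) (N := n) (c := .store (.reg 2) (.sub (.reg 2) (.const 1)) (.const 1))
    (fun r s' => s.Frame 2 s' ∧ ∀ i j, s'.mem i j = if r < i ∧ i ≤ n ∧ j + 1 = i then 1 else 0)
    hn ?_ ?_) ?_
  rotate_left 2
  · rintro s' ⟨h, ⟨hf, hd⟩, -⟩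
    exact ⟨s', h, hf, by funext i j; exact hd i j⟩
  · rintro r hr s₁ ⟨hf, hd⟩ h2
    refine ⟨_, Reaches.store _ _ _ _, h2, hf.setMem.setReg le_rfl, fun i j => ?_⟩
    simp only [Config.setReg_mem, Config.setMem_mem, Config.val, Expr.eval, h2, hd,
      Nat.add_sub_cancel, Function.update_apply, ite_apply]
    split_ifs <;> omega
  · refine ⟨(Config.Frame.refl _ _).setReg le_rfl, fun i j => ?_⟩
    rw [if_neg (by omega), Config.setReg_mem, hm]

/-- `c` times the value of `reg 0`. -/
def mulReg : ℕ → Expr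
  | 0 => .const 0
  | c + 1 => .add (mulReg c) (.reg 0)

theorem val_mulReg (c : ℕ) : s.val (mulReg c) = c * s.reg 0 := by
  induction c with
  | zero => simp [mulReg, Config.val, Expr.eval]
  | succ c ih =>
    rw [Nat.succ_mul, ← ih]
    rfl

/-- The search with `c * n` queries. -/
def search (c : ℕ) : Cmd := .seq initRows (forDown 1 (mulReg c) round)

theorem wins_search (hC : ∀ b y, fullMeas (Fin.cons b y : Bits (n + 1)) (C (plusState (n + 1))) =
      (outcomeProb x b y : ℂ) • basisState (Fin.cons b y : Bits (n + 1))) (c : ℕ)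
    (hn : s.reg 0 = n) (hm : s.mem = fun _ _ => 0) (hρ : s.ρ = basisState 0)
    (hq : s.queries = 0) :
    Wins C x (c * n) (c * n * roundTime n + n * 4 + 7) (s.withCode [search c])
      (1 - (2 ^ n - 1) * (2 / 3) ^ (c * n)) := by
  obtain ⟨s₁, h₁, f₁, m₁⟩ := reaches_initRows (C := C) hn hm
  have r0 : s₁.reg 0 = n := (f₁.reg 0 (by norm_num)).trans hn
  -- The nonlinear term is made opaque so that the time bounds become linear.
  obtain ⟨R, hR⟩ : ∃ R, R = c * n * roundTime n := ⟨_, rfl⟩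
  rw [← hR]
  refine Wins.mono (T := R + 1 + 1 + 1 + (n * 4 + 3) + 1) ?_ (by omega) le_rfl
  refine Wins.seq (h₁.wins (T := R + 1 + 1 + 1) (Wins.seq (T := R + 1 + 1) (Reaches.wins (T := R + 1)
    (Reaches.assign _ _ _) ?_)))
  rw [val_mulReg, r0]
  have hrow : ∀ i : Fin n, s₁.row n (i + 1) = Pi.single i 1 := by
    intro i
    funext j
    have hij : (1 ≤ (i : ℕ) + 1 ∧ (i : ℕ) + 1 ≤ n ∧ (j : ℕ) + 1 = i + 1) ↔ j = i :=
      ⟨fun h => Fin.ext (by omega), fun h => by subst h; omega⟩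
    simp only [Config.row, m₁, hij, Pi.single_apply]
    split_ifs <;> simp
  have hrow0 : s₁.row n 0 = 0 := by
    funext j
    simp [Config.row, m₁]
  -- Row `0` is zero and the other rows are the standard basis, so the initial space is everything,
  -- and the target has itself as coordinates.
  have hready : (s₁.setReg 1 (c * n)).Ready x Finset.univ 1 := by
    refine ⟨by simpa using r0, ?_, ?_, zero_le_one, Finset.mem_univ _, ⟨0, ?_⟩, .inr ⟨fun _ =>
      Finset.mem_univ _, vec x, ?_⟩⟩
    · intro i j
      rw [Config.setReg_mem, m₁]
      dsimp only
      split_ifs <;> omega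
    · funext j
      simp [Config.row, m₁]
    · rw [Config.setReg_ρ, f₁.ρ, Complex.ofReal_one, one_smul, hρ]
    · change s₁.affine (vec x) = _
      rw [Config.affine, hrow0, zero_add]
      simp only [hrow]
      funext j
      simp [Finset.sum_apply, Pi.single_apply]
  have hq₁ : s₁.queries = 0 := f₁.queries.trans hq
  have := wins_rounds (B := c * n) hC (c * n) hready (by simp)
    (by rw [Config.setReg_queries, hq₁, zero_add])
  rw [← hR] at this
  simpa using this

end Search

/-! ### Choice of the number of queries and conclusion -/

/-- The quantity is at most `q^n` with `q = 2 (2/3)^c`. Taking `q ≤ min 1 δ` gives `q^n ≤ q ≤ δ` for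
every `n ≥ 1`. -/
theorem exists_query_factor {δ : ℝ} (hδ : 0 < δ) :
    ∃ c : ℕ, ∀ n : ℕ, ((2 : ℝ) ^ n - 1) * (2 / 3) ^ (c * n) ≤ δ := by
  obtain ⟨c, hc⟩ := exists_pow_lt_of_lt_one (show (0 : ℝ) < min 1 δ / 2 by positivity)
    (show (2 / 3 : ℝ) < 1 by norm_num)
  refine ⟨c, fun n => ?_⟩
  -- For `n = 0` the bound by `q^n = 1` is useless, but the factor `2^0 - 1` vanishes.
  rcases Nat.eq_zero_or_pos n with rfl | hn
  · simpa using hδ.le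
  · have h1 : 2 * (2 / 3 : ℝ) ^ c ≤ min 1 δ := by linarith
    have h0 : 0 ≤ 2 * (2 / 3 : ℝ) ^ c := by positivity
    calc ((2 : ℝ) ^ n - 1) * (2 / 3) ^ (c * n) ≤ 2 ^ n * (2 / 3) ^ (c * n) := by gcongr; linarith
      _ = (2 * (2 / 3 : ℝ) ^ c) ^ n := by rw [mul_pow, pow_mul]
      _ ≤ 2 * (2 / 3 : ℝ) ^ c := pow_le_of_le_one h0 (h1.trans (min_le_left _ _)) hn.ne'
      _ ≤ δ := h1.trans (min_le_right _ _)

end PauliSearch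

end

theorem theorem3 (δ : ℝ) (hδ : 0 < δ) :
    ∃ (P : PauliSearch.Cmd) (c : ℕ) (T : Polynomial ℕ),
      ∀ (n : ℕ) (x : PauliSearch.Bits n)
        (C : PauliSearch.Op (n + 1) →ₗ[ℂ] PauliSearch.Op (n + 1))
        (D : PauliSearch.Op (n + 2) →ₗ[ℂ] PauliSearch.Op (n + 2)),
        PauliSearch.IsPauliSearchingOracle (1 / 3) x C →
        PauliSearch.IsControlledVersion C D →
        PauliSearch.traceFirst (D (PauliSearch.rhoIn n (1 / 3))) = PauliSearch.rhoOut x →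
          (∀ s ∈ PauliSearch.run C (T.eval n) (PauliSearch.initial P n),
            s.code = [] ∧ s.queries ≤ c * n) ∧
          1 - δ ≤ PauliSearch.successProb C P (T.eval n) x := by
  open PauliSearch in
  obtain ⟨c, hc⟩ := exists_query_factor hδ
  refine ⟨search c, c, Polynomial.C c * Polynomial.X *
    (Polynomial.X * (Polynomial.X * 10 + 44) + 60) + Polynomial.X * 4 + 7, ?_⟩
  intro n x C D _ hD hout
  have hw := wins_search (s := initial (search c) n) (fullMeas_oracle (oracle_plusState hD hout)) c
    (by simp [initial]) rfl rfl rfl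
  obtain ⟨h1, h2⟩ := hw _ le_rfl
  have hT : (Polynomial.C c * Polynomial.X * (Polynomial.X * (Polynomial.X * 10 + 44) + 60) +
      Polynomial.X * 4 + 7 : Polynomial ℕ).eval n = c * n * roundTime n + n * 4 + 7 := by
    simp [roundTime]
  rw [hT]
  exact ⟨h1, le_trans (by linarith [hc n]) h2⟩
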